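/- **Model.** Fix real parameters $\lambda>0$, $\mu_0>0$, $K>1$ and $f$ with $\frac1K<f<1$, and put $\mu_{c1}=K\mu_0$, $\mu_{l2}=\mu_0/f$, $\mu_{c2}=K\mu_0/(1-f)$. Consider a two-server offloading system with state space $\mathcal S=\mathbb N_0\times\{0,1\}^2\times\mathbb N_0$. In a state $s=(n_0,i_2,i_1,n_2)$ there are $n_0$ jobs in the base queue, $i_2$ indicates a job in local service under service mode 2 (SM2), $i_1$ indicates a service mode 1 (SM1) job at the cloud, and $n_2$ is the number of SM2 jobs at the cloud; $n(s)=n_0+i_2+i_1+n_2$. Jobs arrive to the base queue as a Poisson process of rate $\lambda$. All service times are independent exponentials. If $i_2=1$, the local server completes its job at rate $\mu_{l2}$, and that job then becomes an SM2 job at the cloud ($i_2\mapsto 0$, $n_2\mapsto n_2+1$). The cloud gives preemptive priority to SM2 jobs: if $n_2\ge1$, an SM2 job leaves the cloud at rate $\mu_{c2}$; if $n_2=0$ and $i_1=1$, the SM1 job leaves at rate $\mu_{c1}$. A (stationary Markovian) policy $\pi$ assigns to each state $s$ an action $\pi(s)\in\mathcal U(s)$, where $\mathtt{idle}\in\mathcal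 U(s)$ always; $\mathtt{SM1}\in\mathcal U(s)$ iff $n_0\ge1$ and $i_1=0$; and $\mathtt{SM2}\in\mathcal U(s)$ iff $n_0\ge1$ and $i_2=0$. The action $\mathtt{SM1}$ moves a job from the base queue to the cloud ($n_0\mapsto n_0-1$, $i_1\mapsto1$), and $\mathtt{SM2}$ moves a job from the base queue to the local server ($n_0\mapsto n_0-1$, $i_2\mapsto1$). Actions are taken at time $0$ and at each arrival and service completion; they take effect instantaneously and are repeated in immediate succession until the policy idles. For a discount rate $\beta>0$, let $$J_\beta(s_0;\pi)=\mathbb E_\pi\Big[\int_0^\infty e^{-\beta t}\,n(s(t))\,dt\,\Big|\,s(0)=s_0\Big],\qquad V_\beta(s_0)=\inf_\pi J_\beta(s_0;\pi),$$ the infimum being over all stationary Markovian policies. A policy $\pi^*$ is *delay-optimal* if $J_\beta(s_0;\pi^*)=V_\beta(s_0)$ for all $s_0\in\mathcal S$. **Proposition.** Let $\beta>0$ and let $\pi^*$ be a delay-optimal policy. Then there exists a threshold $N_0\in\mathbb N_0$ such that, for all $n_0\in\mathbb N_0$, $$\pi^*(n_0,0,1,0)=\begin{cases}\mathtt{idle}&\text{if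 } n_0<N_0,\\ \mathtt{SM2}&\text{if } n_0\ge N_0.\end{cases}$$ -/

import Mathlib

namespace Offload

open MeasureTheory ProbabilityTheory

/-- Parameters of the two-server offloading system, with its standing assumptions: Poisson arrivals
of rate `lam`, local capacity `mu0`, cloud capacity `K * mu0` with `K > 1`, and the fraction `f` of
a job that is processed locally in service mode 2, with `1 / K < f < 1`. -/
structure Model where
  lam : ℝ
  mu0 : ℝ
  K : ℝ
  f : ℝ
  lam_pos : 0 < lam
  mu0_pos : 0 < mu0
  one_lt_K : 1 < K
  inv_K_lt_f : 1 / K < f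
  f_lt_one : f < 1

namespace Model

/-- Cloud service rate of a mode 1 job. -/
noncomputable def muC1 (M : Model) : ℝ := M.K * M.mu0

/-- Local service rate of a mode 2 job. -/
noncomputable def muL2 (M : Model) : ℝ := M.mu0 / M.f

/-- Cloud service rate of a mode 2 job. -/
noncomputable def muC2 (M : Model) : ℝ := M.K * M.mu0 / (1 - M.f)

theorem muC1_pos (M : Model) : 0 < M.muC1 :=
  mul_pos (lt_trans one_pos M.one_lt_K) M.mu0_pos

theorem muL2_pos (M : Model) : 0 < M.muL2 :=
  div_pos M.mu0_pos
    (lt_trans (one_div_pos.mpr (lt_trans one_pos M.one_lt_K)) M.inv_K_lt_f)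

theorem muC2_pos (M : Model) : 0 < M.muC2 :=
  div_pos M.muC1_pos (sub_pos.mpr M.f_lt_one)

end Model

/-- A state `(n₀, i₂, i₁, n₂)`: the number `n₀` of jobs in the base queue, the indicator `i₂` of a
mode 2 job at the local server, the indicator `i₁` of a mode 1 job at the cloud, and the number
`n₂` of mode 2 jobs at the cloud. -/
abbrev State : Type := ℕ × Fin 2 × Fin 2 × ℕ

/-- Total number of jobs in the system. -/
def jobs : State → ℕ
  | (n0, i2, i1, n2) => n0 + i2.val + i1.val + n2

inductive Action : Type
  | idle
  | SM1
  | SM2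

/-- The admissible actions `𝒰(s)`. -/
def admissible : State → Set Action
  | (n0, i2, i1, _) =>
    if 1 ≤ n0 ∧ i2 = 0 ∧ i1 = 0 then {Action.idle, Action.SM1, Action.SM2}
    else if 1 ≤ n0 ∧ i2 = 1 ∧ i1 = 0 then {Action.idle, Action.SM1}
    else if 1 ≤ n0 ∧ i2 = 0 ∧ i1 = 1 then {Action.idle, Action.SM2}
    else {Action.idle}

/-! Transition operators. They are total functions; each is only used on its natural domain. -/

/-- Arrival. -/
def opA : State → State
  | (n0, i2, i1, n2) => (n0 + 1, i2, i1, n2)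

/-- Departure of the mode 1 job from the cloud (domain `i₁ = 1`). -/
def opD1 : State → State
  | (n0, i2, _, n2) => (n0, i2, 0, n2)

/-- Departure of a mode 2 job from the cloud (domain `n₂ ≥ 1`). -/
def opD2 : State → State
  | (n0, i2, i1, n2) => (n0, i2, i1, n2 - 1)

/-- Local completion of a mode 2 job, which moves on to the cloud (domain `i₂ = 1`). -/
def opDL : State → State
  | (n0, i2, i1, n2) => (n0, 0, i1, n2 + i2.val)

/-- Assignment of a job to mode 1 (domain `n₀ ≥ 1`, `i₁ = 0`). -/
def opU1 : State → State
  | (n0, i2, _, n2) => (n0 - 1, i2, 1, n2)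

/-- Assignment of a job to mode 2 (domain `n₀ ≥ 1`, `i₂ = 0`). -/
def opU2 : State → State
  | (n0, _, i1, n2) => (n0 - 1, 1, i1, n2)

/-- The instantaneous effect of an action. -/
def applyAction : Action → State → State
  | Action.idle, s => s
  | Action.SM1, s => opU1 s
  | Action.SM2, s => opU2 s

/-- A stationary Markovian policy. -/
structure Policy where
  act : State → Action
  act_mem : ∀ s, act s ∈ admissible s

/-- The state after a decision instant at which the system is found in state `s`: the actions
prescribed by the policy are carried out in immediate succession until it idles. At most two
assignments are possible (see `act_settle`), so two steps suffice. -/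
def settle (π : Policy) : State → State :=
  (fun s => applyAction (π.act s) s)^[2]

/-- After the decision instant, the policy idles. -/
theorem act_settle (π : Policy) (s : State) : π.act (settle π s) = Action.idle := by
  have key : ∀ s : State, π.act s = Action.idle ∨
      (π.act s = Action.SM1 ∧ s.2.2.1 = 0) ∨ (π.act s = Action.SM2 ∧ s.2.1 = 0) := by
    rintro ⟨n0, i2, i1, n2⟩
    have h := π.act_mem (n0, i2, i1, n2)
    unfold admissible at h
    dsimp only at h
    split_ifs at h with h1 h2 h3 <;>
      simp only [Set.mem_insert_iff, Set.mem_singleton_iff] at h <;> tauto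
  obtain ⟨n0, i2, i1, n2⟩ := s
  simp only [settle, Function.iterate_succ, Function.iterate_zero, Function.comp_apply, id]
  rcases key (n0, i2, i1, n2) with h | ⟨h, h'⟩ | ⟨h, h'⟩
  · simp only [h, applyAction]
  · rcases key (opU1 (n0, i2, i1, n2)) with k | ⟨k, k'⟩ | ⟨k, k'⟩
    · simp only [h, k, applyAction]
    · simp [opU1] at k'
    · rcases key (opU2 (opU1 (n0, i2, i1, n2))) with l | ⟨l, l'⟩ | ⟨l, l'⟩
      · simp only [h, k, l, applyAction]
      · simp [opU1, opU2] at l'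
      · simp [opU1, opU2] at l'
  · rcases key (opU2 (n0, i2, i1, n2)) with k | ⟨k, k'⟩ | ⟨k, k'⟩
    · simp only [h, k, applyAction]
    · rcases key (opU1 (opU2 (n0, i2, i1, n2))) with l | ⟨l, l'⟩ | ⟨l, l'⟩
      · simp only [h, k, l, applyAction]
      · simp [opU1, opU2] at l'
      · simp [opU1, opU2] at l'
    · simp [opU2] at k'

/-- Completion rate at the local server. -/
noncomputable def localRate (M : Model) : State → ℝ
  | (_, i2, _, _) => if i2 = 1 then M.muL2 else 0

/-- Completion rate at the cloud, which gives (preemptive) priority to mode 2 jobs. -/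
noncomputable def cloudRate (M : Model) : State → ℝ
  | (_, _, i1, n2) => if 1 ≤ n2 then M.muC2 else if i1 = 1 then M.muC1 else 0

/-- Effect of a service completion at the cloud. -/
def cloudDeparture (s : State) : State :=
  if 1 ≤ s.2.2.2 then opD2 s else opD1 s

/-- Total rate at which the system leaves state `s`. -/
noncomputable def totalRate (M : Model) (s : State) : ℝ :=
  M.lam + localRate M s + cloudRate M s

theorem localRate_nonneg (M : Model) (s : State) : 0 ≤ localRate M s := by
  obtain ⟨n0, i2, i1, n2⟩ := s
  have := M.muL2_pos.le
  unfold localRate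
  dsimp only
  split_ifs <;> simp [this]

theorem cloudRate_nonneg (M : Model) (s : State) : 0 ≤ cloudRate M s := by
  obtain ⟨n0, i2, i1, n2⟩ := s
  have := M.muC1_pos.le
  have := M.muC2_pos.le
  unfold cloudRate
  dsimp only
  split_ifs <;> simp [*]

theorem totalRate_pos (M : Model) (s : State) : 0 < totalRate M s := by
  have := localRate_nonneg M s
  have := cloudRate_nonneg M s
  have := M.lam_pos
  unfold totalRate
  linarith

/-- Law of the state after the next transition (and the decisions taken there) from state `s`: each
possible event occurs with probability proportional to its rate. -/
noncomputable def jumpLaw (M : Model) (π : Policy) (s : State) : Measure State :=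
  (ENNReal.ofReal (totalRate M s))⁻¹ •
    (ENNReal.ofReal M.lam • Measure.dirac (settle π (opA s)) +
      ENNReal.ofReal (localRate M s) • Measure.dirac (settle π (opDL s)) +
      ENNReal.ofReal (cloudRate M s) • Measure.dirac (settle π (cloudDeparture s)))

instance (M : Model) (π : Policy) (s : State) : IsProbabilityMeasure (jumpLaw M π s) := by
  constructor
  have hpos := totalRate_pos M s
  simp only [jumpLaw, Measure.smul_apply, Measure.add_apply, measure_univ, smul_eq_mul, mul_one]
  rw [← ENNReal.ofReal_add M.lam_pos.le (localRate_nonneg M s),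
    ← ENNReal.ofReal_add (add_nonneg M.lam_pos.le (localRate_nonneg M s)) (cloudRate_nonneg M s)]
  exact ENNReal.inv_mul_cancel (ENNReal.ofReal_pos.mpr hpos).ne' ENNReal.ofReal_ne_top

/-- One step of the jump chain from state `s`: the next state, and independently the holding time
in `s`, exponential with rate `totalRate M s`. -/
noncomputable def stepKernel (M : Model) (π : Policy) : Kernel State (State × ℝ) where
  toFun s := (jumpLaw M π s).prod (expMeasure (totalRate M s))
  measurable' := Measurable.of_discrete

instance (M : Model) (π : Policy) : IsMarkovKernel (stepKernel M π) := by
  constructor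
  intro s
  have := isProbabilityMeasure_expMeasure (totalRate_pos M s)
  change IsProbabilityMeasure ((jumpLaw M π s).prod (expMeasure (totalRate M s)))
  infer_instance

/-- The step kernel as a function of the past of the jump chain. -/
noncomputable def historyKernel (M : Model) (π : Policy) (n : ℕ) :
    Kernel ((i : Finset.Iic n) → (fun _ : ℕ => State × ℝ) i) (State × ℝ) :=
  (stepKernel M π).comap (fun h => (h ⟨n, Finset.mem_Iic.mpr le_rfl⟩).1)
    (measurable_fst.comp (measurable_pi_apply _))

instance (M : Model) (π : Policy) (n : ℕ) : IsMarkovKernel (historyKernel M π n) :=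
  inferInstanceAs (IsMarkovKernel (Kernel.comap _ _ _))

/-- Law of the sample path under policy `π` when the system is in state `s₀` at time `0`, a decision
instant. A sample path `ω` lists the successive states `(ω k).1`, with `(ω (k + 1)).2` the holding
time in state `(ω k).1`; by convention `(ω 0).2 = 0`. -/
noncomputable def pathLaw (M : Model) (π : Policy) (s₀ : State) : Measure (ℕ → State × ℝ) :=
  Kernel.traj (X := fun _ => State × ℝ) (historyKernel M π) 0 (fun _ => (settle π s₀, 0))

/-- The time of the `k`-th transition. -/
noncomputable def jumpTime (ω : ℕ → State × ℝ) (k : ℕ) : ℝ :=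
  ∑ i ∈ Finset.range (k + 1), (ω i).2

/-- The state at time `t`, i.e. the state after the last transition up to time `t`. -/
noncomputable def stateAt (ω : ℕ → State × ℝ) (t : ℝ) : State :=
  (ω (sSup {k : ℕ | jumpTime ω k ≤ t})).1

/-- The discounted cost-to-go `J_β(s₀; π) = 𝔼[∫₀^∞ e^{-βt} n(t) dt]`. -/
noncomputable def cost (M : Model) (β : ℝ) (π : Policy) (s₀ : State) : ENNReal :=
  ∫⁻ ω, (∫⁻ t in Set.Ici (0 : ℝ),
    ENNReal.ofReal (Real.exp (-β * t)) * (jobs (stateAt ω t) : ENNReal)) ∂(pathLaw M π s₀)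

/-- The value function `V_β`. -/
noncomputable def value (M : Model) (β : ℝ) (s₀ : State) : ENNReal :=
  ⨅ π : Policy, cost M β π s₀

/-- A delay-optimal policy attains the value function from every initial state. -/
def DelayOptimal (M : Model) (β : ℝ) (π : Policy) : Prop :=
  ∀ s₀ : State, cost M β π s₀ = value M β s₀

end Offload

namespace Offload

open MeasureTheory ProbabilityTheory Filter Topology

/-! ### The exponential holding times -/

/-! The proof first reduces the problem to optimality equations. The transition rates are bounded,
so sample paths almost surely do not explode and the cost is a series of discounted stage costs
(`cost_eq_idleCost`). The number of jobs plus a constant contracts in the mean over a discounted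
transition, so this series is finite (`idleCost_le`). The verification lemma
`realCost_le_of_superharmonic`, applied to deviations in a single state, shows that the cost `v` of
an optimal policy solves the optimality equations (`DelayOptimal.isOptimalValue`).

In state (n+1, 0, 1, 0) mode 1 is inadmissible, so the decision is governed by the sign of D(n) =
`modeGap`: the cost of idling until the next event minus the cost after assigning mode 2. Matching
the events out of the two states gives, with q = β + λ + μ_c1 + μ_l2 and a constant g > 0, q D(n+1)
≥ λ min(D(n+2), 0) + μ_c1 min(D(n), 0) + μ_l2 g (`modeGap_recursion`). This is a birth-death
inequality with killing and a positive source. By the minimum principle `nonneg_of_birthDeath`, D(n)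
≥ 0 forces D > 0 from n+1 on (`IsOptimalValue.modeGap_succ_pos`), and D cannot stay negative forever
(`IsOptimalValue.exists_modeGap_nonneg`). Hence D changes sign exactly once, apart from one possible
tie.

The recursion rests on monotonicity of `v` and on the comparisons `IsOptimalValue.SM1_le_base` and
`IsOptimalValue.cloud_le_base`. These are proved by uniformization: events of two states are paired
at a common total rate, and the ordering μ_l2 < μ_c1 < μ_c2 makes every leftover term have the right
sign. -/

theorem expMeasure_eq_withDensity (r : ℝ) :
    expMeasure r = volume.withDensity (exponentialPDF r) := rfl

theorem measurable_exponentialPDF (r : ℝ) : Measurable (exponentialPDF r) :=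
  (measurable_exponentialPDFReal r).ennreal_ofReal

theorem ae_nonneg_expMeasure (r : ℝ) : ∀ᵐ h ∂(expMeasure r), 0 ≤ h := by
  rw [expMeasure_eq_withDensity, ae_withDensity_iff (measurable_exponentialPDF r)]
  refine ae_of_all _ fun h hh => ?_
  by_contra hneg
  exact hh (exponentialPDF_of_neg (not_le.mp hneg))

/-- Laplace transform of the exponential distribution. -/
theorem lintegral_exp_expMeasure {r β : ℝ} (hr : 0 < r) (hβ : 0 < β) :
    ∫⁻ h, ENNReal.ofReal (Real.exp (-β * h)) ∂(expMeasure r) = ENNReal.ofReal (r / (r + β)) := by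
  rw [expMeasure_eq_withDensity,
    lintegral_withDensity_eq_lintegral_mul _ (measurable_exponentialPDF r) (by fun_prop)]
  have key : ∀ h : ℝ, (exponentialPDF r * fun h => ENNReal.ofReal (Real.exp (-β * h))) h =
      ENNReal.ofReal (r / (r + β)) * exponentialPDF (r + β) h := by
    intro h
    simp only [Pi.mul_apply, exponentialPDF_eq]
    rw [← ENNReal.ofReal_mul' (Real.exp_pos _).le, ← ENNReal.ofReal_mul (by positivity)]
    congr 1
    split_ifs
    · have : Real.exp (-((r + β) * h)) = Real.exp (-(r * h)) * Real.exp (-β * h) := by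
        rw [← Real.exp_add]; ring_nf
      rw [this]; field_simp
    · simp
  simp_rw [key]
  rw [lintegral_const_mul _ (measurable_exponentialPDF _),
    lintegral_exponentialPDF_eq_one (by positivity), mul_one]

/-- Adding the Laplace transform divided by β makes the integrand constant almost surely, so the
value follows by cancellation. It is the expected discounted length of a holding time. -/
theorem lintegral_one_sub_exp_expMeasure {r β : ℝ} (hr : 0 < r) (hβ : 0 < β) :
    ∫⁻ h, ENNReal.ofReal ((1 - Real.exp (-β * h)) / β) ∂(expMeasure r) =
      ENNReal.ofReal (1 / (r + β)) := by
  have := isProbabilityMeasure_expMeasure hr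
  have h1 : ∫⁻ h, (ENNReal.ofReal ((1 - Real.exp (-β * h)) / β) +
      ENNReal.ofReal (1 / β) * ENNReal.ofReal (Real.exp (-β * h))) ∂(expMeasure r) =
      ENNReal.ofReal (1 / β) := by
    rw [lintegral_congr_ae (g := fun _ => ENNReal.ofReal (1 / β)), lintegral_const, measure_univ,
      mul_one]
    filter_upwards [ae_nonneg_expMeasure r] with h hh
    have : Real.exp (-β * h) ≤ 1 := Real.exp_le_one_iff.mpr (by nlinarith)
    rw [← ENNReal.ofReal_mul (by positivity), ← ENNReal.ofReal_add
      (div_nonneg (by linarith) hβ.le) (by positivity)]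
    congr 1
    field_simp
    ring
  rw [lintegral_add_right _ (by fun_prop), lintegral_const_mul _ (by fun_prop),
    lintegral_exp_expMeasure hr hβ, ← ENNReal.ofReal_mul (by positivity)] at h1
  have h2 : ENNReal.ofReal (1 / β) =
      ENNReal.ofReal (1 / (r + β)) + ENNReal.ofReal (1 / β * (r / (r + β))) := by
    rw [← ENNReal.ofReal_add (by positivity) (by positivity)]
    congr 1
    field_simp
    ring
  rw [h2] at h1
  exact (ENNReal.add_left_inj ENNReal.ofReal_ne_top).mp h1

/-! ### One step of the jump chain -/

/-- Discounted expectation of a function of the state after the next transition. -/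
noncomputable def discountedStep (M : Model) (β : ℝ) (π : Policy) (φ : State → ENNReal)
    (s : State) : ENNReal :=
  ENNReal.ofReal (totalRate M s / (totalRate M s + β)) * ∫⁻ x, φ x ∂(jumpLaw M π s)

theorem lintegral_jumpLaw (M : Model) (π : Policy) (φ : State → ENNReal) (s : State) :
    ∫⁻ x, φ x ∂(jumpLaw M π s) = (ENNReal.ofReal (totalRate M s))⁻¹ *
      (ENNReal.ofReal M.lam * φ (settle π (opA s)) +
        ENNReal.ofReal (localRate M s) * φ (settle π (opDL s)) +
        ENNReal.ofReal (cloudRate M s) * φ (settle π (cloudDeparture s))) := by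
  simp only [jumpLaw, lintegral_smul_measure, lintegral_add_measure, lintegral_dirac, smul_eq_mul]

theorem stepKernel_apply (M : Model) (π : Policy) (s : State) :
    stepKernel M π s = (jumpLaw M π s).prod (expMeasure (totalRate M s)) := rfl

theorem lintegral_stepKernel_mul (M : Model) (π : Policy) (s : State) (φ : State → ENNReal)
    {ψ : ℝ → ENNReal} (hψ : Measurable ψ) :
    ∫⁻ y, φ y.1 * ψ y.2 ∂(stepKernel M π s) =
      (∫⁻ x, φ x ∂(jumpLaw M π s)) * ∫⁻ h, ψ h ∂(expMeasure (totalRate M s)) := by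
  have := isProbabilityMeasure_expMeasure (totalRate_pos M s)
  rw [stepKernel_apply]
  exact lintegral_prod_mul (Measurable.of_discrete (f := φ)).aemeasurable hψ.aemeasurable

theorem measurable_jumpTime (k : ℕ) : Measurable fun ω : ℕ → State × ℝ => jumpTime ω k := by
  unfold jumpTime
  fun_prop

/-- The discount factor at the `k`-th transition. -/
noncomputable def discount (β : ℝ) (ω : ℕ → State × ℝ) (k : ℕ) : ENNReal :=
  ENNReal.ofReal (Real.exp (-β * jumpTime ω k))

theorem measurable_discount (β : ℝ) (k : ℕ) :
    Measurable fun ω : ℕ → State × ℝ => discount β ω k := by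
  have := measurable_jumpTime k
  unfold discount
  fun_prop

instance (M : Model) (π : Policy) (s₀ : State) : IsProbabilityMeasure (pathLaw M π s₀) := by
  unfold pathLaw
  infer_instance

/-- Markov property: integrating out the transition after the first `k`. -/
theorem lintegral_pathLaw_succ (M : Model) (π : Policy) (s₀ : State) (k : ℕ)
    {F : ((i : Finset.Iic k) → State × ℝ) × (State × ℝ) → ENNReal} (hF : Measurable F) :
    ∫⁻ ω, F (Preorder.frestrictLe k ω, ω (k + 1)) ∂(pathLaw M π s₀) =
      ∫⁻ ω, ∫⁻ y, F (Preorder.frestrictLe k ω, y) ∂(stepKernel M π (ω k).1)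
        ∂(pathLaw M π s₀) := by
  have h := Kernel.partialTraj_compProd_eq_map_traj (X := fun _ => State × ℝ)
    (κ := historyKernel M π) (Nat.zero_le k) (x₀ := fun _ => (settle π s₀, 0))
  have h1 := congrArg (fun μ => ∫⁻ z, F z ∂μ) h
  rw [lintegral_map hF (by fun_prop), Measure.lintegral_compProd hF,
    ← Kernel.traj_map_frestrictLe_apply] at h1
  rw [lintegral_map (Measurable.lintegral_kernel_prod_right' hF) (by fun_prop)] at h1
  exact h1.symm

theorem lintegral_discount_mul (M : Model) (β : ℝ) (π : Policy) (s₀ : State) (k : ℕ)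
    {ψ : State × (State × ℝ) → ENNReal} (hψ : Measurable ψ) :
    ∫⁻ ω, discount β ω k * ψ ((ω k).1, ω (k + 1)) ∂(pathLaw M π s₀) =
      ∫⁻ ω, discount β ω k * ∫⁻ y, ψ ((ω k).1, y) ∂(stepKernel M π (ω k).1)
        ∂(pathLaw M π s₀) := by
  -- The discount at the `k`-th transition depends only on the first `k` steps; `D` expresses it
  -- through that history, so that the Markov property applies.
  let D : ((i : Finset.Iic k) → State × ℝ) → ENNReal := fun h =>
    ENNReal.ofReal (Real.exp (-β * ∑ i : Finset.Iic k, (h i).2))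
  have hD : ∀ ω : ℕ → State × ℝ, D (Preorder.frestrictLe k ω) = discount β ω k := by
    intro ω
    simp only [D, discount, jumpTime, Preorder.frestrictLe_apply]
    have : ∑ i : Finset.Iic k, (ω i).2 = ∑ i ∈ Finset.range (k + 1), (ω i).2 := by
      rw [Finset.sum_coe_sort (Finset.Iic k) (fun i => (ω i).2)]
      congr 1
      ext i
      simp
    rw [this]
  have hDm : Measurable D := by fun_prop
  have h := lintegral_pathLaw_succ M π s₀ k
    (F := fun z => D z.1 * ψ ((z.1 ⟨k, Finset.mem_Iic.mpr le_rfl⟩).1, z.2)) (by fun_prop)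
  simp only [hD, Preorder.frestrictLe_apply] at h
  rw [h]
  refine lintegral_congr fun ω => ?_
  rw [lintegral_const_mul]
  fun_prop

theorem lintegral_discount_succ (M : Model) {β : ℝ} (hβ : 0 < β) (π : Policy) (s₀ : State) (k : ℕ)
    (φ : State → ENNReal) :
    ∫⁻ ω, discount β ω (k + 1) * φ (ω (k + 1)).1 ∂(pathLaw M π s₀) =
      ∫⁻ ω, discount β ω k * discountedStep M β π φ (ω k).1 ∂(pathLaw M π s₀) := by
  have hφ : Measurable φ := Measurable.of_discrete
  have h := lintegral_discount_mul M β π s₀ k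
    (ψ := fun z => φ z.2.1 * ENNReal.ofReal (Real.exp (-β * z.2.2))) (by fun_prop)
  have h2 : ∀ ω : ℕ → State × ℝ, discount β ω (k + 1) * φ (ω (k + 1)).1 =
      discount β ω k * (φ (ω (k + 1)).1 * ENNReal.ofReal (Real.exp (-β * (ω (k + 1)).2))) := by
    intro ω
    have : discount β ω (k + 1) =
        discount β ω k * ENNReal.ofReal (Real.exp (-β * (ω (k + 1)).2)) := by
      rw [discount, discount, ← ENNReal.ofReal_mul (Real.exp_pos _).le, ← Real.exp_add]
      congr 2
      simp only [jumpTime, Finset.sum_range_succ _ (k + 1)]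
      ring
    rw [this]; ring
  simp_rw [h2]
  rw [h]
  refine lintegral_congr fun ω => ?_
  rw [lintegral_stepKernel_mul M π _ φ (ψ := fun h => ENNReal.ofReal (Real.exp (-β * h)))
    (by fun_prop), lintegral_exp_expMeasure (totalRate_pos M _) hβ, discountedStep, mul_comm
    (ENNReal.ofReal _)]

theorem lintegral_pathLaw_zero (M : Model) (π : Policy) (s₀ : State) {f : State × ℝ → ENNReal}
    (hf : Measurable f) :
    ∫⁻ ω, f (ω 0) ∂(pathLaw M π s₀) = f (settle π s₀, 0) := by
  unfold pathLaw
  rw [Kernel.lintegral_traj _ (by fun_prop)]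
  simp [Function.updateFinset]

/-- This turns path integrals into iterates of an operator on functions of the state. The induction
peels off the last transition, which changes `φ`; hence `φ` stays quantified. -/
theorem lintegral_discount (M : Model) {β : ℝ} (hβ : 0 < β) (π : Policy) (s₀ : State) (k : ℕ) :
    ∀ φ : State → ENNReal,
      ∫⁻ ω, discount β ω k * φ (ω k).1 ∂(pathLaw M π s₀) =
        (discountedStep M β π)^[k] φ (settle π s₀) := by
  induction k with
  | zero =>
    intro φ
    have hφ : Measurable φ := Measurable.of_discrete
    have h := lintegral_pathLaw_zero M π s₀
      (f := fun y => ENNReal.ofReal (Real.exp (-β * y.2)) * φ y.1) (by fun_prop)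
    simpa [discount, jumpTime] using h
  | succ k ih =>
    intro φ
    rw [lintegral_discount_succ M hβ, ih, Function.iterate_succ_apply]

/-! ### Regular sample paths -/

/-- The sample paths that start at time `0`, have nonnegative holding times, and do not explode. -/
def RegularPath (ω : ℕ → State × ℝ) : Prop :=
  (ω 0).2 = 0 ∧ (∀ k, 0 ≤ (ω (k + 1)).2) ∧ Tendsto (jumpTime ω) atTop atTop

theorem jumpTime_succ (ω : ℕ → State × ℝ) (k : ℕ) :
    jumpTime ω (k + 1) = jumpTime ω k + (ω (k + 1)).2 :=
  Finset.sum_range_succ _ _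

theorem jumpTime_zero (ω : ℕ → State × ℝ) : jumpTime ω 0 = (ω 0).2 := by
  simp [jumpTime]

theorem monotone_jumpTime {ω : ℕ → State × ℝ} (h : ∀ k, 0 ≤ (ω (k + 1)).2) :
    Monotone (jumpTime ω) :=
  monotone_nat_of_le_succ fun k => by rw [jumpTime_succ]; linarith [h k]

theorem stateAt_eq {ω : ℕ → State × ℝ} (h : Monotone (jumpTime ω)) {k : ℕ} {t : ℝ}
    (h1 : jumpTime ω k ≤ t) (h2 : t < jumpTime ω (k + 1)) : stateAt ω t = (ω k).1 := by
  -- `sSup` on ℕ is a default value for unbounded sets; the bracket around `t` makes `k` an actual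
  -- maximum, also when some holding times vanish.
  have : IsGreatest {k : ℕ | jumpTime ω k ≤ t} k := by
    refine ⟨h1, fun j hj => ?_⟩
    by_contra hlt
    have : jumpTime ω (k + 1) ≤ jumpTime ω j := h (by omega)
    have hj' : jumpTime ω j ≤ t := hj
    linarith
  rw [stateAt, this.csSup_eq]

/-- Non-explosion provides a first transition after `t`; it is not the `0`-th, since that one is at
time `0`, and its predecessor brackets `t`. -/
theorem iUnion_Ico_jumpTime {ω : ℕ → State × ℝ} (h : RegularPath ω) :
    ⋃ k, Set.Ico (jumpTime ω k) (jumpTime ω (k + 1)) = Set.Ici 0 := by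
  obtain ⟨h0, h1, h2⟩ := h
  have hm := monotone_jumpTime h1
  ext t
  simp only [Set.mem_iUnion, Set.mem_Ico, Set.mem_Ici]
  constructor
  · rintro ⟨k, hk, -⟩
    have := hm (Nat.zero_le k)
    rw [jumpTime_zero, h0] at this
    linarith
  · intro ht
    have hex : ∃ k, t < jumpTime ω k := (h2.eventually_gt_atTop t).exists
    classical
    have hpos : Nat.find hex ≠ 0 := by
      intro hz
      have := Nat.find_spec hex
      rw [hz, jumpTime_zero, h0] at this
      linarith
    obtain ⟨k, hk⟩ := Nat.exists_eq_succ_of_ne_zero hpos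
    refine ⟨k, not_lt.mp (Nat.find_min hex (by omega)), ?_⟩
    have := Nat.find_spec hex
    rwa [hk] at this

theorem lintegral_Ico_exp {β : ℝ} (hβ : 0 < β) {a b : ℝ} (hab : a ≤ b) :
    ∫⁻ t in Set.Ico a b, ENNReal.ofReal (Real.exp (-β * t)) =
      ENNReal.ofReal (Real.exp (-β * a) * ((1 - Real.exp (-β * (b - a))) / β)) := by
  have hint : IntervalIntegrable (fun t => Real.exp (-β * t)) volume a b :=
    (by fun_prop : Continuous fun t => Real.exp (-β * t)).intervalIntegrable a b
  rw [setLIntegral_congr Ico_ae_eq_Ioc, ← ofReal_integral_eq_lintegral_ofReal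
    ((intervalIntegrable_iff_integrableOn_Ioc_of_le hab).mp hint)
    (ae_of_all _ fun t => (Real.exp_pos _).le), ← intervalIntegral.integral_of_le hab]
  congr 1
  have hd : ∀ x ∈ Set.uIcc a b,
      HasDerivAt (fun t => -Real.exp (-β * t) / β) (Real.exp (-β * x)) x := by
    intro x _
    have := (((hasDerivAt_id x).const_mul (-β)).exp.neg).div_const β
    refine this.congr_deriv ?_
    simp only [id, mul_one]
    field_simp
  rw [intervalIntegral.integral_eq_sub_of_hasDerivAt hd hint]
  have : Real.exp (-β * b) = Real.exp (-β * a) * Real.exp (-β * (b - a)) := by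
    rw [← Real.exp_add]; ring_nf
  rw [this]
  field_simp
  ring

/-- The discounted cost along a sample path, summed over the transitions. -/
theorem lintegral_stateAt {β : ℝ} (hβ : 0 < β) {ω : ℕ → State × ℝ} (h : RegularPath ω) :
    ∫⁻ t in Set.Ici (0 : ℝ), ENNReal.ofReal (Real.exp (-β * t)) * (jobs (stateAt ω t) : ENNReal) =
      ∑' k, discount β ω k * ((jobs (ω k).1 : ENNReal) *
        ENNReal.ofReal ((1 - Real.exp (-β * (ω (k + 1)).2)) / β)) := by
  have hm := monotone_jumpTime h.2.1
  rw [← iUnion_Ico_jumpTime h, lintegral_iUnion (fun _ => measurableSet_Ico)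
    (by simpa using hm.pairwise_disjoint_on_Ico_succ)]
  refine tsum_congr fun k => ?_
  rw [setLIntegral_congr_fun measurableSet_Ico
    (g := fun t => ENNReal.ofReal (Real.exp (-β * t)) * (jobs (ω k).1 : ENNReal))
    (fun t ht => by simp only [stateAt_eq hm ht.1 ht.2]),
    lintegral_mul_const _ (by fun_prop), lintegral_Ico_exp hβ (hm (Nat.le_succ k)),
    ENNReal.ofReal_mul (Real.exp_pos _).le, jumpTime_succ, add_sub_cancel_left, discount]
  ring

/-! ### Jump rates are bounded, so sample paths are regular -/

/-- An upper bound for the rates at which the system leaves a state. -/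
noncomputable def Model.rateBound (M : Model) : ℝ := M.lam + M.muL2 + M.muC1 + M.muC2

theorem totalRate_le (M : Model) (s : State) : totalRate M s ≤ M.rateBound := by
  obtain ⟨n0, i2, i1, n2⟩ := s
  have := M.muL2_pos
  have := M.muC1_pos
  have := M.muC2_pos
  simp only [totalRate, localRate, cloudRate, Model.rateBound]
  split_ifs <;> linarith

theorem discountedStep_mono (M : Model) (β : ℝ) (π : Policy) {φ ψ : State → ENNReal}
    (h : ∀ s, φ s ≤ ψ s) (s : State) : discountedStep M β π φ s ≤ discountedStep M β π ψ s :=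
  mul_le_mul_right (lintegral_mono h) _

theorem discountedStep_const_mul (M : Model) (β : ℝ) (π : Policy) (φ : State → ENNReal)
    (a : ENNReal) (s : State) :
    discountedStep M β π (fun x => a * φ x) s = a * discountedStep M β π φ s := by
  rw [discountedStep, discountedStep, lintegral_const_mul _ Measurable.of_discrete]
  ring

theorem iterate_discountedStep_le (M : Model) (β : ℝ) (π : Policy) {φ ψ : State → ENNReal}
    {a : ENNReal} (h : ∀ s, φ s ≤ ψ s) (hψ : ∀ s, discountedStep M β π ψ s ≤ a * ψ s) (k : ℕ) :
    ∀ s, (discountedStep M β π)^[k] φ s ≤ a ^ k * ψ s := by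
  induction k with
  | zero => simpa using h
  | succ k ih =>
    intro s
    rw [Function.iterate_succ_apply']
    refine (discountedStep_mono M β π ih s).trans ?_
    rw [discountedStep_const_mul, pow_succ, mul_assoc]
    exact mul_le_mul_right (hψ s) _

theorem lintegral_discount_le (M : Model) (π : Policy) (s₀ : State) (k : ℕ) :
    ∫⁻ ω, discount 1 ω k ∂(pathLaw M π s₀) ≤
      ENNReal.ofReal (M.rateBound / (M.rateBound + 1)) ^ k := by
  have h := lintegral_discount M one_pos π s₀ k (fun _ => 1)
  simp only [mul_one] at h
  rw [h]
  have := iterate_discountedStep_le M 1 π (φ := fun _ => 1) (ψ := fun _ => 1)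
    (a := ENNReal.ofReal (M.rateBound / (M.rateBound + 1))) (fun _ => le_rfl) (fun s => ?_) k
    (settle π s₀)
  · simpa using this
  · simp only [discountedStep, lintegral_const, measure_univ, mul_one]
    have h1 := totalRate_pos M s
    have h2 := totalRate_le M s
    refine ENNReal.ofReal_le_ofReal ?_
    rw [div_le_div_iff₀ (by linarith) (by linarith)]
    nlinarith

theorem ae_holdingTime_nonneg (M : Model) (π : Policy) (s₀ : State) :
    ∀ᵐ ω ∂(pathLaw M π s₀), ∀ k, 0 ≤ (ω (k + 1)).2 := by
  rw [ae_all_iff]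
  intro k
  have hs : MeasurableSet {y : State × ℝ | y.2 < 0} :=
    measurableSet_lt measurable_snd measurable_const
  have h := lintegral_pathLaw_succ M π s₀ k
    (F := fun z => Set.indicator {y : State × ℝ | y.2 < 0} (fun _ => 1) z.2)
    ((measurable_const.indicator hs).comp measurable_snd)
  have h0 : ∀ s, ∫⁻ y, Set.indicator {y : State × ℝ | y.2 < 0} (fun _ => (1 : ENNReal)) y
      ∂(stepKernel M π s) = 0 := by
    intro s
    have := isProbabilityMeasure_expMeasure (totalRate_pos M s)
    rw [lintegral_indicator hs, setLIntegral_one, stepKernel_apply]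
    have : {y : State × ℝ | y.2 < 0} = Set.univ ×ˢ Set.Iio 0 := by ext; simp
    rw [this, Measure.prod_prod]
    have h2 := ae_nonneg_expMeasure (totalRate M s)
    rw [ae_iff] at h2
    simp only [not_le] at h2
    change _ * expMeasure (totalRate M s) {a | a < 0} = 0
    rw [h2, mul_zero]
  simp only [h0, lintegral_zero] at h
  have hm : Measurable fun ω : ℕ → State × ℝ =>
      Set.indicator {y : State × ℝ | y.2 < 0} (fun _ => (1 : ENNReal)) (ω (k + 1)) :=
    (measurable_const.indicator hs).comp (measurable_pi_apply _)
  rw [lintegral_eq_zero_iff hm] at h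
  filter_upwards [h] with ω hω
  by_contra hneg
  have : ω (k + 1) ∈ {y : State × ℝ | y.2 < 0} := not_le.mp hneg
  simp [Set.indicator_of_mem this] at hω

theorem ae_startTime_zero (M : Model) (π : Policy) (s₀ : State) :
    ∀ᵐ ω ∂(pathLaw M π s₀), (ω 0).2 = 0 := by
  have hs : MeasurableSet {y : State × ℝ | y.2 ≠ 0} :=
    (measurable_snd (measurableSet_singleton 0)).compl
  have h := lintegral_pathLaw_zero M π s₀
    (f := Set.indicator {y : State × ℝ | y.2 ≠ 0} fun _ => 1) (measurable_const.indicator hs)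
  have hm : Measurable fun ω : ℕ → State × ℝ =>
      Set.indicator {y : State × ℝ | y.2 ≠ 0} (fun _ => (1 : ENNReal)) (ω 0) :=
    (measurable_const.indicator hs).comp (measurable_pi_apply _)
  rw [Set.indicator_of_notMem (by simp), lintegral_eq_zero_iff hm] at h
  filter_upwards [h] with ω hω
  by_contra hne
  have : ω 0 ∈ {y : State × ℝ | y.2 ≠ 0} := hne
  simp [Set.indicator_of_mem this] at hω

/-- The expectation of exp(-T_k) decays geometrically because the rates are bounded, so the infimum
of exp(-T_k) over k vanishes almost surely. On a path with bounded jump times that infimum would be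
positive. The discount rate 1 used here is arbitrary and unrelated to β. -/
theorem ae_tendsto_jumpTime (M : Model) (π : Policy) (s₀ : State) :
    ∀ᵐ ω ∂(pathLaw M π s₀), Tendsto (jumpTime ω) atTop atTop := by
  have hR : 0 < M.rateBound := (totalRate_pos M (0, 0, 0, 0)).trans_le (totalRate_le M _)
  have hzero : ∫⁻ ω, ⨅ k, discount 1 ω k ∂(pathLaw M π s₀) = 0 := by
    refine le_antisymm ?_ zero_le
    have hlim : Tendsto (fun k : ℕ => ENNReal.ofReal (M.rateBound / (M.rateBound + 1)) ^ k) atTop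
        (𝓝 0) := by
      refine ENNReal.tendsto_pow_atTop_nhds_zero_of_lt_one ?_
      rw [ENNReal.ofReal_lt_one, div_lt_one (by linarith)]
      linarith
    refine ge_of_tendsto' hlim fun k => ?_
    exact (lintegral_mono fun ω => iInf_le _ k).trans (lintegral_discount_le M π s₀ k)
  rw [lintegral_eq_zero_iff (Measurable.iInf fun k => measurable_discount 1 k)] at hzero
  filter_upwards [hzero, ae_holdingTime_nonneg M π s₀] with ω h1 h2
  refine tendsto_atTop_atTop_of_monotone (monotone_jumpTime h2) fun b => ?_
  by_contra hcon
  push Not at hcon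
  have : ENNReal.ofReal (Real.exp (-b)) ≤ ⨅ k, discount 1 ω k := by
    refine le_iInf fun k => ENNReal.ofReal_le_ofReal (Real.exp_le_exp.mpr ?_)
    linarith [hcon k]
  simp only [Pi.zero_apply] at h1
  rw [h1] at this
  have h3 := ENNReal.ofReal_pos.mpr (Real.exp_pos (-b))
  exact absurd (lt_of_lt_of_le h3 this) (lt_irrefl _)

theorem ae_regularPath (M : Model) (π : Policy) (s₀ : State) :
    ∀ᵐ ω ∂(pathLaw M π s₀), RegularPath ω := by
  filter_upwards [ae_startTime_zero M π s₀, ae_holdingTime_nonneg M π s₀,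
    ae_tendsto_jumpTime M π s₀] with ω h1 h2 h3
  exact ⟨h1, h2, h3⟩

/-! ### The cost as a sum over transitions -/

/-- The expected discounted cost incurred before the next transition. -/
noncomputable def stageCost (M : Model) (β : ℝ) (s : State) : ENNReal :=
  (jobs s : ENNReal) * ENNReal.ofReal (1 / (totalRate M s + β))

/-- The discounted cost-to-go just after a decision instant. -/
noncomputable def idleCost (M : Model) (β : ℝ) (π : Policy) (s : State) : ENNReal :=
  ∑' k, (discountedStep M β π)^[k] (stageCost M β) s

theorem cost_eq_idleCost (M : Model) {β : ℝ} (hβ : 0 < β) (π : Policy) (s₀ : State) :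
    cost M β π s₀ = idleCost M β π (settle π s₀) := by
  have hm : ∀ k, Measurable fun ω : ℕ → State × ℝ => discount β ω k *
      ((jobs (ω k).1 : ENNReal) * ENNReal.ofReal ((1 - Real.exp (-β * (ω (k + 1)).2)) / β)) := by
    intro k
    have h1 := measurable_discount β k
    have h2 : Measurable fun s : State => (jobs s : ENNReal) := Measurable.of_discrete
    fun_prop
  rw [cost, lintegral_congr_ae ((ae_regularPath M π s₀).mono fun ω h => lintegral_stateAt hβ h),
    lintegral_tsum fun k => (hm k).aemeasurable, idleCost]
  refine tsum_congr fun k => ?_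
  have h2 : Measurable fun s : State => (jobs s : ENNReal) := Measurable.of_discrete
  rw [lintegral_discount_mul M β π s₀ k (ψ := fun z => (jobs z.1 : ENNReal) *
    ENNReal.ofReal ((1 - Real.exp (-β * z.2.2)) / β)) (by fun_prop), ← lintegral_discount M hβ]
  refine lintegral_congr fun ω => ?_
  congr 1
  rw [lintegral_stepKernel_mul M π _ (fun _ => (jobs (ω k).1 : ENNReal))
    (ψ := fun h => ENNReal.ofReal ((1 - Real.exp (-β * h)) / β)) (by fun_prop),
    lintegral_one_sub_exp_expMeasure (totalRate_pos M _) hβ]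
  simp [stageCost]

/-- The zeroth term of the series is the stage cost, and the operator commutes with countable sums
of nonnegative functions. -/
theorem idleCost_eq (M : Model) (β : ℝ) (π : Policy) (s : State) :
    idleCost M β π s = stageCost M β s + discountedStep M β π (idleCost M β π) s := by
  rw [idleCost, tsum_eq_zero_add' ENNReal.summable, Function.iterate_zero_apply]
  congr 1
  simp only [Function.iterate_succ_apply', discountedStep, idleCost]
  rw [lintegral_tsum fun k => Measurable.of_discrete.aemeasurable, ENNReal.tsum_mul_left]

/-! ### Real-valued cost and its recursion -/

theorem jobs_applyAction (π : Policy) (s : State) : jobs (applyAction (π.act s) s) = jobs s := by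
  obtain ⟨n0, i2, i1, n2⟩ := s
  have h := π.act_mem (n0, i2, i1, n2)
  unfold admissible at h
  dsimp only at h
  split_ifs at h with h1 h2 h3 <;>
    simp only [Set.mem_insert_iff, Set.mem_singleton_iff] at h
  · obtain ⟨h0, rfl, rfl⟩ := h1
    rcases h with h | h | h <;> simp [h, applyAction, opU1, opU2, jobs] <;> omega
  · obtain ⟨h0, rfl, rfl⟩ := h2
    rcases h with h | h <;> (simp [h, applyAction, opU1, jobs]; try omega)
  · obtain ⟨h0, rfl, rfl⟩ := h3
    rcases h with h | h <;> (simp [h, applyAction, opU2, jobs]; try omega)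
  · simp [h, applyAction]

theorem jobs_settle (π : Policy) (s : State) : jobs (settle π s) = jobs s := by
  simp only [settle, Function.iterate_succ, Function.iterate_zero, Function.comp_apply, id,
    jobs_applyAction]

theorem settle_of_idle {π : Policy} {s : State} (h : π.act s = Action.idle) : settle π s = s := by
  simp [settle, h, applyAction]

/-- Both sides are iterates of the same map, three and two times; the third application is idle by
`act_settle`. -/
theorem settle_applyAction (π : Policy) (s : State) :
    settle π (applyAction (π.act s) s) = settle π s := by
  have h : applyAction (π.act (settle π s)) (settle π s) = settle π s := by
    rw [act_settle]; rfl
  exact h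

theorem jobs_opA (s : State) : jobs (opA s) = jobs s + 1 := by
  obtain ⟨n0, i2, i1, n2⟩ := s
  simp only [opA, jobs]; omega

theorem jobs_opDL (s : State) : jobs (opDL s) = jobs s := by
  obtain ⟨n0, i2, i1, n2⟩ := s
  simp only [opDL, jobs, Fin.val_zero]; omega

theorem jobs_cloudDeparture_le (s : State) : jobs (cloudDeparture s) ≤ jobs s := by
  obtain ⟨n0, i2, i1, n2⟩ := s
  unfold cloudDeparture
  split_ifs <;> simp only [opD1, opD2, jobs, Fin.val_zero] <;> omega

theorem discountedStep_eq (M : Model) {β : ℝ} (hβ : 0 < β) (π : Policy) (φ : State → ENNReal)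
    (s : State) :
    discountedStep M β π φ s = ENNReal.ofReal (1 / (totalRate M s + β)) *
      (ENNReal.ofReal M.lam * φ (settle π (opA s)) +
        ENNReal.ofReal (localRate M s) * φ (settle π (opDL s)) +
        ENNReal.ofReal (cloudRate M s) * φ (settle π (cloudDeparture s))) := by
  have h := totalRate_pos M s
  rw [discountedStep, lintegral_jumpLaw, ← mul_assoc, ← ENNReal.ofReal_inv_of_pos h,
    ← ENNReal.ofReal_mul (by positivity)]
  congr 2
  field_simp

theorem discountedStep_ofReal (M : Model) {β : ℝ} (hβ : 0 < β) (π : Policy) {g : State → ℝ}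
    (hg : ∀ s, 0 ≤ g s) (s : State) :
    discountedStep M β π (fun x => ENNReal.ofReal (g x)) s = ENNReal.ofReal
      ((M.lam * g (settle π (opA s)) + localRate M s * g (settle π (opDL s)) +
        cloudRate M s * g (settle π (cloudDeparture s))) / (totalRate M s + β)) := by
  have h := totalRate_pos M s
  have h1 := mul_nonneg M.lam_pos.le (hg (settle π (opA s)))
  have h2 := mul_nonneg (localRate_nonneg M s) (hg (settle π (opDL s)))
  have h3 := mul_nonneg (cloudRate_nonneg M s) (hg (settle π (cloudDeparture s)))
  rw [discountedStep_eq M hβ, ← ENNReal.ofReal_mul M.lam_pos.le,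
    ← ENNReal.ofReal_mul (localRate_nonneg M s), ← ENNReal.ofReal_mul (cloudRate_nonneg M s),
    ← ENNReal.ofReal_add h1 h2, ← ENNReal.ofReal_add (add_nonneg h1 h2) h3,
    ← ENNReal.ofReal_mul (by positivity)]
  congr 1
  ring

/-- A weight that contracts, in the mean, over one discounted transition. -/
noncomputable def weight (M : Model) (β : ℝ) (s : State) : ℝ := jobs s + 2 * M.lam / β

/-- The contraction factor of `weight`. -/
noncomputable def contraction (M : Model) (β : ℝ) : ℝ :=
  (M.rateBound + β / 2) / (M.rateBound + β)

theorem rateBound_pos (M : Model) : 0 < M.rateBound :=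
  (totalRate_pos M (0, 0, 0, 0)).trans_le (totalRate_le M _)

theorem contraction_nonneg (M : Model) {β : ℝ} (hβ : 0 < β) : 0 ≤ contraction M β := by
  have := rateBound_pos M
  unfold contraction; positivity

theorem contraction_lt_one (M : Model) {β : ℝ} (hβ : 0 < β) : contraction M β < 1 := by
  have := rateBound_pos M
  rw [contraction, div_lt_one (by positivity)]
  linarith

theorem two_lam_div_le_weight (M : Model) (β : ℝ) (s : State) : 2 * M.lam / β ≤ weight M β s := by
  have : (0 : ℝ) ≤ jobs s := Nat.cast_nonneg _
  unfold weight; linarith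

theorem weight_pos (M : Model) {β : ℝ} (hβ : 0 < β) (s : State) : 0 < weight M β s :=
  (div_pos (mul_pos two_pos M.lam_pos) hβ).trans_le (two_lam_div_le_weight M β s)

theorem weight_mono (M : Model) (β : ℝ) {s t : State} (h : jobs s ≤ jobs t) :
    weight M β s ≤ weight M β t := by
  have : (jobs s : ℝ) ≤ jobs t := Nat.cast_le.mpr h
  unfold weight; linarith

theorem weight_opA (M : Model) (β : ℝ) (s : State) : weight M β (opA s) = weight M β s + 1 := by
  simp only [weight, jobs_opA]; push_cast; ring

/-- If all rates out of a state sum up to at most `R ≤ rateBound`, a discounted transition contracts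
the weight. -/
theorem rate_mul_weight_le (M : Model) {β : ℝ} (hβ : 0 < β) {R w : ℝ} (hR : R ≤ M.rateBound)
    (hw : 2 * M.lam / β ≤ w) :
    R * w + M.lam ≤ contraction M β * (w * (R + β)) := by
  have hB := rateBound_pos M
  -- The offset 2λ/β in the weight is chosen for this: half of the discounting pays for the upward
  -- drift λ of arrivals, and the other half remains as contraction.
  have hw' : M.lam ≤ w * (β / 2) := by
    rw [div_le_iff₀ hβ] at hw; linarith
  have hw0 : 0 < w := (div_pos (mul_pos two_pos M.lam_pos) hβ).trans_le hw
  have h1 : R + β / 2 ≤ contraction M β * (R + β) := by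
    rw [contraction, div_mul_eq_mul_div, le_div_iff₀ (by positivity)]
    nlinarith
  nlinarith [mul_le_mul_of_nonneg_left h1 hw0.le]

/-- Assignments preserve the number of jobs and service completions never raise it, so only arrivals
increase the weight, by one each. -/
theorem discountedStep_weight_le (M : Model) {β : ℝ} (hβ : 0 < β) (π : Policy) (s : State) :
    discountedStep M β π (fun x => ENNReal.ofReal (weight M β x)) s ≤
      ENNReal.ofReal (contraction M β) * ENNReal.ofReal (weight M β s) := by
  have hT := totalRate_pos M s
  rw [discountedStep_ofReal M hβ π fun x => (weight_pos M hβ x).le,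
    ← ENNReal.ofReal_mul (contraction_nonneg M hβ)]
  refine ENNReal.ofReal_le_ofReal ?_
  rw [div_le_iff₀ (by positivity)]
  have h1 : weight M β (settle π (opA s)) ≤ weight M β s + 1 := by
    rw [← weight_opA]; exact weight_mono M β (jobs_settle π _).le
  have h2 : weight M β (settle π (opDL s)) ≤ weight M β s :=
    weight_mono M β (by rw [jobs_settle, jobs_opDL])
  have h3 : weight M β (settle π (cloudDeparture s)) ≤ weight M β s :=
    weight_mono M β (by rw [jobs_settle]; exact jobs_cloudDeparture_le s)
  have := rate_mul_weight_le M hβ (totalRate_le M s) (two_lam_div_le_weight M β s)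
  have e1 := mul_le_mul_of_nonneg_left h1 M.lam_pos.le
  have e2 := mul_le_mul_of_nonneg_left h2 (localRate_nonneg M s)
  have e3 := mul_le_mul_of_nonneg_left h3 (cloudRate_nonneg M s)
  have : totalRate M s * weight M β s = M.lam * weight M β s + localRate M s * weight M β s +
    cloudRate M s * weight M β s := by unfold totalRate; ring
  linarith

theorem stageCost_le (M : Model) {β : ℝ} (hβ : 0 < β) (s : State) :
    stageCost M β s ≤ ENNReal.ofReal (1 / β) * ENNReal.ofReal (weight M β s) := by
  have hT := totalRate_pos M s
  rw [stageCost, mul_comm, ← ENNReal.ofReal_natCast]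
  have : 0 ≤ 2 * M.lam / β := (div_pos (mul_pos two_pos M.lam_pos) hβ).le
  gcongr
  · linarith
  · unfold weight; linarith

/-- The `k`-th term of the series is at most the `k`-th power of the contraction factor times the
weight; a geometric series bounds the sum uniformly in the policy. -/
theorem idleCost_le (M : Model) {β : ℝ} (hβ : 0 < β) (π : Policy) (s : State) :
    idleCost M β π s ≤ (1 - ENNReal.ofReal (contraction M β))⁻¹ *
      (ENNReal.ofReal (1 / β) * ENNReal.ofReal (weight M β s)) := by
  rw [idleCost, ← ENNReal.tsum_geometric, ← ENNReal.tsum_mul_right]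
  refine ENNReal.tsum_le_tsum fun k => ?_
  refine iterate_discountedStep_le M β π
    (ψ := fun s => ENNReal.ofReal (1 / β) * ENNReal.ofReal (weight M β s))
    (stageCost_le M hβ) (fun s => ?_) k s
  rw [discountedStep_const_mul, mul_left_comm]
  exact mul_le_mul_right (discountedStep_weight_le M hβ π s) _

/-- The discounted cost-to-go as a real number. -/
noncomputable def realCost (M : Model) (β : ℝ) (π : Policy) (s : State) : ℝ :=
  (cost M β π s).toReal

theorem geometric_ne_top (M : Model) {β : ℝ} (hβ : 0 < β) :
    (1 - ENNReal.ofReal (contraction M β))⁻¹ ≠ ⊤ := by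
  rw [ENNReal.inv_ne_top]
  exact (tsub_pos_of_lt (ENNReal.ofReal_lt_one.mpr (contraction_lt_one M hβ))).ne'

theorem cost_ne_top (M : Model) {β : ℝ} (hβ : 0 < β) (π : Policy) (s : State) :
    cost M β π s ≠ ⊤ := by
  rw [cost_eq_idleCost M hβ]
  refine ne_top_of_le_ne_top ?_ (idleCost_le M hβ π _)
  exact ENNReal.mul_ne_top (geometric_ne_top M hβ)
    (ENNReal.mul_ne_top ENNReal.ofReal_ne_top ENNReal.ofReal_ne_top)

theorem realCost_nonneg (M : Model) (β : ℝ) (π : Policy) (s : State) : 0 ≤ realCost M β π s :=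
  ENNReal.toReal_nonneg

/-- A bound, uniform in the policy, for the cost relative to the weight. -/
noncomputable def costBound (M : Model) (β : ℝ) : ℝ :=
  (1 - ENNReal.ofReal (contraction M β))⁻¹.toReal * (1 / β)

theorem costBound_nonneg (M : Model) {β : ℝ} (hβ : 0 < β) : 0 ≤ costBound M β :=
  mul_nonneg ENNReal.toReal_nonneg (by positivity)

theorem realCost_le (M : Model) {β : ℝ} (hβ : 0 < β) (π : Policy) (s : State) :
    realCost M β π s ≤ costBound M β * weight M β s := by
  have h := idleCost_le M hβ π (settle π s)
  rw [← cost_eq_idleCost M hβ] at h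
  have h2 := ENNReal.toReal_mono (ENNReal.mul_ne_top (geometric_ne_top M hβ)
    (ENNReal.mul_ne_top ENNReal.ofReal_ne_top ENNReal.ofReal_ne_top)) h
  rw [ENNReal.toReal_mul, ENNReal.toReal_mul, ENNReal.toReal_ofReal (by positivity),
    ENNReal.toReal_ofReal (weight_pos M hβ _).le] at h2
  have : weight M β (settle π s) = weight M β s := by unfold weight; rw [jobs_settle]
  rw [this] at h2
  unfold realCost costBound
  linarith

theorem realCost_settle (M : Model) {β : ℝ} (hβ : 0 < β) (π : Policy) (s : State) :
    realCost M β π (settle π s) = realCost M β π s := by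
  rw [realCost, realCost, cost_eq_idleCost M hβ, cost_eq_idleCost M hβ,
    settle_of_idle (act_settle π s)]

/-- The expected cost-to-go, up to the factor `β + totalRate M s`, when the system idles in state `s`
until the next transition and the cost-to-go is `v` from then on. -/
noncomputable def idleRHS (M : Model) (v : State → ℝ) (s : State) : ℝ :=
  jobs s + M.lam * v (opA s) + localRate M s * v (opDL s) +
    cloudRate M s * v (cloudDeparture s)

theorem realCost_of_idle (M : Model) {β : ℝ} (hβ : 0 < β) {π : Policy} {s : State}
    (h : π.act s = Action.idle) :
    (β + totalRate M s) * realCost M β π s = idleRHS M (realCost M β π) s := by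
  have hT := totalRate_pos M s
  have hfin : ∀ x, cost M β π x = ENNReal.ofReal (realCost M β π x) := fun x =>
    (ENNReal.ofReal_toReal (cost_ne_top M hβ π x)).symm
  have h1 : cost M β π s = stageCost M β s + ENNReal.ofReal (1 / (totalRate M s + β)) *
      (ENNReal.ofReal M.lam * cost M β π (opA s) +
        ENNReal.ofReal (localRate M s) * cost M β π (opDL s) +
        ENNReal.ofReal (cloudRate M s) * cost M β π (cloudDeparture s)) := by
    rw [cost_eq_idleCost M hβ π s, settle_of_idle h, idleCost_eq, discountedStep_eq M hβ,
      cost_eq_idleCost M hβ π, cost_eq_idleCost M hβ π, cost_eq_idleCost M hβ π]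
  have e1 := mul_nonneg M.lam_pos.le (realCost_nonneg M β π (opA s))
  have e2 := mul_nonneg (localRate_nonneg M s) (realCost_nonneg M β π (opDL s))
  have e3 := mul_nonneg (cloudRate_nonneg M s) (realCost_nonneg M β π (cloudDeparture s))
  simp only [hfin, stageCost] at h1
  rw [← ENNReal.ofReal_mul M.lam_pos.le, ← ENNReal.ofReal_mul (localRate_nonneg M s),
    ← ENNReal.ofReal_mul (cloudRate_nonneg M s), ← ENNReal.ofReal_add e1 e2,
    ← ENNReal.ofReal_add (add_nonneg e1 e2) e3, ← ENNReal.ofReal_natCast,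
    ← ENNReal.ofReal_mul (Nat.cast_nonneg _), ← ENNReal.ofReal_mul (by positivity),
    ← ENNReal.ofReal_add (by positivity) (by positivity),
    ENNReal.ofReal_eq_ofReal_iff (realCost_nonneg M β π s) (by positivity)] at h1
  rw [h1, idleRHS]
  field_simp
  ring

/-- A function that is bounded below by a multiple of a weight is nonnegative if every such bound can
be improved by a factor `ρ < 1`. -/
theorem nonneg_of_contraction {ι : Type*} {e w : ι → ℝ} {ρ K₀ : ℝ} (hρ0 : 0 ≤ ρ) (hρ1 : ρ < 1)
    (hK₀ : 0 ≤ K₀) (h0 : ∀ i, -(K₀ * w i) ≤ e i)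
    (step : ∀ K, 0 ≤ K → (∀ i, -(K * w i) ≤ e i) → ∀ i, -(ρ * K * w i) ≤ e i) (i : ι) :
    0 ≤ e i := by
  have hk : ∀ k : ℕ, ∀ i, -(ρ ^ k * K₀ * w i) ≤ e i := by
    intro k
    induction k with
    | zero => simpa using h0
    | succ k ih =>
      intro i
      have := step (ρ ^ k * K₀) (by positivity) ih i
      rwa [← mul_assoc, ← pow_succ'] at this
  have hlim : Tendsto (fun k : ℕ => -(ρ ^ k * K₀ * w i)) atTop (𝓝 0) := by
    have := (((tendsto_pow_atTop_nhds_zero_of_lt_one hρ0 hρ1).mul_const K₀).mul_const (w i)).neg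
    simpa using this
  exact le_of_tendsto' hlim fun k => hk k i

/-! ### Policy comparison and the optimality equations -/

theorem realCost_applyAction (M : Model) {β : ℝ} (hβ : 0 < β) (π : Policy) (s : State) :
    realCost M β π (applyAction (π.act s) s) = realCost M β π s := by
  rw [← realCost_settle M hβ, settle_applyAction, realCost_settle M hβ]

theorem idleRHS_sub (M : Model) (u v : State → ℝ) (s : State) :
    idleRHS M u s - idleRHS M v s = M.lam * (u (opA s) - v (opA s)) +
      localRate M s * (u (opDL s) - v (opDL s)) +
      cloudRate M s * (u (cloudDeparture s) - v (cloudDeparture s)) := by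
  unfold idleRHS; ring

theorem neg_weight_le_rates (M : Model) {β : ℝ} (hβ : 0 < β) {e : State → ℝ} {K : ℝ} (hK : 0 ≤ K)
    (he : ∀ s, -(K * weight M β s) ≤ e s) (s : State) :
    -(contraction M β * K * weight M β s * (β + totalRate M s)) ≤
      M.lam * e (opA s) + localRate M s * e (opDL s) + cloudRate M s * e (cloudDeparture s) := by
  have h1 := he (opA s)
  rw [weight_opA] at h1
  have h2 : -(K * weight M β s) ≤ e (opDL s) := by
    have := he (opDL s)
    have h := weight_mono M β (jobs_opDL s).le
    nlinarith
  have h3 : -(K * weight M β s) ≤ e (cloudDeparture s) := by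
    have := he (cloudDeparture s)
    have h := weight_mono M β (jobs_cloudDeparture_le s)
    nlinarith
  have e1 := mul_le_mul_of_nonneg_left h1 M.lam_pos.le
  have e2 := mul_le_mul_of_nonneg_left h2 (localRate_nonneg M s)
  have e3 := mul_le_mul_of_nonneg_left h3 (cloudRate_nonneg M s)
  have h := mul_le_mul_of_nonneg_left
    (rate_mul_weight_le M hβ (totalRate_le M s) (two_lam_div_le_weight M β s)) hK
  have : totalRate M s * weight M β s = M.lam * weight M β s + localRate M s * weight M β s +
    cloudRate M s * weight M β s := by unfold totalRate; ring
  rw [this] at h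
  linarith

/-- Verification lemma. The difference of `v` and the cost is bounded below by a multiple of the
weight. Moving to the settled state, where the policy idles, and taking one transition improves that
bound by the contraction factor. -/
theorem realCost_le_of_superharmonic (M : Model) {β : ℝ} (hβ : 0 < β) {π : Policy} {v : State → ℝ}
    (h0 : ∀ s, 0 ≤ v s) (h1 : ∀ s, v (applyAction (π.act s) s) ≤ v s)
    (h2 : ∀ s, π.act s = Action.idle → idleRHS M v s ≤ (β + totalRate M s) * v s) (s : State) :
    realCost M β π s ≤ v s := by
  rw [← sub_nonneg]
  refine nonneg_of_contraction (e := fun s => v s - realCost M β π s) (w := weight M β)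
    (contraction_nonneg M hβ) (contraction_lt_one M hβ) (costBound_nonneg M hβ)
    (fun s => by linarith [h0 s, realCost_le M hβ π s]) (fun K hK he s => ?_) s
  have hv : v (settle π s) ≤ v s := by
    simp only [settle, Function.iterate_succ, Function.iterate_zero, Function.comp_apply, id]
    exact (h1 _).trans (h1 s)
  have hi := act_settle π s
  have hT := totalRate_pos M (settle π s)
  have hu := neg_weight_le_rates M hβ hK he (settle π s)
  have e1 := h2 _ hi
  have e2 := realCost_of_idle M hβ hi
  have e3 := idleRHS_sub M v (realCost M β π) (settle π s)
  have hw : weight M β (settle π s) = weight M β s := by unfold weight; rw [jobs_settle]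
  rw [hw] at hu
  have : -(contraction M β * K * weight M β s) * (β + totalRate M (settle π s)) ≤
      (v (settle π s) - realCost M β π (settle π s)) * (β + totalRate M (settle π s)) := by
    linarith
  have := le_of_mul_le_mul_right this (by positivity)
  rw [realCost_settle M hβ] at this
  linarith

theorem DelayOptimal.realCost_le {M : Model} {β : ℝ} (hβ : 0 < β) {π : Policy}
    (hπ : DelayOptimal M β π) (π' : Policy) (s : State) : realCost M β π s ≤ realCost M β π' s := by
  refine ENNReal.toReal_mono (cost_ne_top M hβ π' s) ?_
  rw [hπ s]
  exact iInf_le _ π'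

/-- The policy that deviates from `π` in state `s` only, where it takes action `a`. -/
def Policy.modify (π : Policy) (s : State) (a : Action) (ha : a ∈ admissible s) : Policy where
  act := Function.update π.act s a
  act_mem x := by
    by_cases h : x = s
    · subst h; simpa using ha
    · rw [Function.update_of_ne h]; exact π.act_mem x

theorem Policy.modify_act_self (π : Policy) (s : State) (a : Action) (ha : a ∈ admissible s) :
    (π.modify s a ha).act s = a := Function.update_self ..

theorem Policy.modify_act_of_ne (π : Policy) {s x : State} (a : Action) (ha : a ∈ admissible s)
    (h : x ≠ s) : (π.modify s a ha).act x = π.act x := Function.update_of_ne h ..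

/-- The old cost is superharmonic for the modified policy, so the deviation costs no more; by
optimality it costs no less. A strictly profitable deviation then contradicts the modified policy's
own cost equation in `s`. -/
theorem DelayOptimal.realCost_modify {M : Model} {β : ℝ} (hβ : 0 < β) {π : Policy}
    (hπ : DelayOptimal M β π) {s : State} {a : Action} (ha : a ∈ admissible s)
    (h1 : realCost M β π (applyAction a s) ≤ realCost M β π s)
    (h2 : a = Action.idle → idleRHS M (realCost M β π) s ≤
      (β + totalRate M s) * realCost M β π s) :
    realCost M β (π.modify s a ha) = realCost M β π := by
  funext x
  refine le_antisymm ?_ (hπ.realCost_le hβ _ x)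
  refine realCost_le_of_superharmonic M hβ (realCost_nonneg M β π) (fun x => ?_) (fun x hx => ?_) x
  · by_cases hxs : x = s
    · rw [hxs, Policy.modify_act_self]; exact h1
    · rw [Policy.modify_act_of_ne _ _ _ hxs, realCost_applyAction M hβ]
  · by_cases hxs : x = s
    · subst hxs
      rw [Policy.modify_act_self] at hx
      exact h2 hx
    · rw [Policy.modify_act_of_ne _ _ _ hxs] at hx
      exact (realCost_of_idle M hβ hx).ge

/-- No admissible action decreases the optimal cost-to-go. -/
theorem DelayOptimal.realCost_le_applyAction {M : Model} {β : ℝ} (hβ : 0 < β) {π : Policy}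
    (hπ : DelayOptimal M β π) {s : State} {a : Action} (ha : a ∈ admissible s) :
    realCost M β π s ≤ realCost M β π (applyAction a s) := by
  by_contra hlt
  push Not at hlt
  have hne : a ≠ Action.idle := by
    rintro rfl
    exact lt_irrefl _ hlt
  have h := hπ.realCost_modify hβ ha hlt.le fun h => absurd h hne
  have h2 := realCost_applyAction M hβ (π.modify s a ha) s
  rw [Policy.modify_act_self, h] at h2
  exact hlt.ne h2

/-- Idling until the next transition does not decrease the optimal cost-to-go. -/
theorem DelayOptimal.realCost_le_idleRHS {M : Model} {β : ℝ} (hβ : 0 < β) {π : Policy}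
    (hπ : DelayOptimal M β π) (s : State) :
    (β + totalRate M s) * realCost M β π s ≤ idleRHS M (realCost M β π) s := by
  by_contra hlt
  push Not at hlt
  have ha : Action.idle ∈ admissible s := by
    obtain ⟨n0, i2, i1, n2⟩ := s
    unfold admissible
    dsimp only
    split_ifs <;> simp
  have h := hπ.realCost_modify hβ ha le_rfl fun _ => hlt.le
  have h2 := realCost_of_idle M hβ (π.modify_act_self s _ ha)
  rw [h] at h2
  exact hlt.ne h2.symm

/-- The optimality equations. -/
structure IsOptimalValue (M : Model) (β : ℝ) (v : State → ℝ) : Prop where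
  nonneg : ∀ s, 0 ≤ v s
  exists_le_weight : ∃ K, 0 ≤ K ∧ ∀ s, v s ≤ K * weight M β s
  le_idle : ∀ s, (β + totalRate M s) * v s ≤ idleRHS M v s
  le_action : ∀ s, ∀ a ∈ admissible s, v s ≤ v (applyAction a s)
  attained : ∀ s, (β + totalRate M s) * v s = idleRHS M v s ∨
    (Action.SM1 ∈ admissible s ∧ v s = v (opU1 s)) ∨ (Action.SM2 ∈ admissible s ∧ v s = v (opU2 s))

theorem DelayOptimal.isOptimalValue {M : Model} {β : ℝ} (hβ : 0 < β) {π : Policy}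
    (hπ : DelayOptimal M β π) : IsOptimalValue M β (realCost M β π) where
  nonneg := realCost_nonneg M β π
  exists_le_weight := ⟨costBound M β, costBound_nonneg M hβ, Offload.realCost_le M hβ π⟩
  le_idle := hπ.realCost_le_idleRHS hβ
  le_action _ _ ha := hπ.realCost_le_applyAction hβ ha
  attained s := by
    have h := π.act_mem s
    have h2 := realCost_applyAction M hβ π s
    cases hs : π.act s with
    | idle => exact Or.inl (realCost_of_idle M hβ hs)
    | SM1 => rw [hs] at h h2; exact Or.inr (Or.inl ⟨h, h2.symm⟩)
    | SM2 => rw [hs] at h h2; exact Or.inr (Or.inr ⟨h, h2.symm⟩)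

/-! ### Monotonicity of the optimal value -/

namespace Model

/-- The assumption 1/K < f enters the comparisons through this inequality. -/
theorem muL2_lt_muC1 (M : Model) : M.muL2 < M.muC1 := by
  have hK : 0 < M.K := one_pos.trans M.one_lt_K
  have hf : 0 < M.f := (one_div_pos.mpr hK).trans M.inv_K_lt_f
  have h := M.inv_K_lt_f
  rw [div_lt_iff₀ hK] at h
  rw [muL2, muC1, div_lt_iff₀ hf]
  nlinarith [M.mu0_pos]

theorem muC1_lt_muC2 (M : Model) : M.muC1 < M.muC2 := by
  have hK : 0 < M.K := one_pos.trans M.one_lt_K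
  have hf : 0 < M.f := (one_div_pos.mpr hK).trans M.inv_K_lt_f
  have h := M.muC1_pos
  have h1 : 0 < 1 - M.f := sub_pos.mpr M.f_lt_one
  change M.muC1 < M.muC1 / (1 - M.f)
  rw [lt_div_iff₀ h1]
  nlinarith

end Model

variable {M : Model} {β : ℝ} {v : State → ℝ}

theorem SM1_mem_admissible {n0 n2 : ℕ} {i2 i1 : Fin 2} :
    Action.SM1 ∈ admissible (n0, i2, i1, n2) ↔ 1 ≤ n0 ∧ i1 = 0 := by
  unfold admissible
  dsimp only
  obtain rfl | rfl : i2 = 0 ∨ i2 = 1 := by omega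
  all_goals split_ifs <;> simp <;> tauto

theorem SM2_mem_admissible {n0 n2 : ℕ} {i2 i1 : Fin 2} :
    Action.SM2 ∈ admissible (n0, i2, i1, n2) ↔ 1 ≤ n0 ∧ i2 = 0 := by
  unfold admissible
  dsimp only
  obtain rfl | rfl : i1 = 0 ∨ i1 = 1 := by omega
  all_goals split_ifs <;> simp <;> tauto

theorem IsOptimalValue.le_SM1 (hv : IsOptimalValue M β v) (n n2 : ℕ) (i2 : Fin 2) :
    v (n + 1, i2, 0, n2) ≤ v (n, i2, 1, n2) :=
  hv.le_action (n + 1, i2, 0, n2) Action.SM1 (SM1_mem_admissible.mpr ⟨by omega, rfl⟩)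

theorem IsOptimalValue.le_SM2 (hv : IsOptimalValue M β v) (n n2 : ℕ) (i1 : Fin 2) :
    v (n + 1, 0, i1, n2) ≤ v (n, 1, i1, n2) :=
  hv.le_action (n + 1, 0, i1, n2) Action.SM2 (SM2_mem_admissible.mpr ⟨by omega, rfl⟩)

/-- Comparison of the local transitions in two ordered states, after uniformization. -/
theorem localRate_compare {B : ℝ} {s t : State} (hst : s ≤ t)
    (hB : ∀ s' t' : State, s' ≤ t' → jobs t' ≤ jobs t → -B ≤ v t' - v s') :
    -(M.muL2 * (B + (v t - v s))) ≤
      localRate M t * (v (opDL t) - v t) - localRate M s * (v (opDL s) - v s) := by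
  have hν := M.muL2_pos
  have h0 := hB s t hst le_rfl
  have hDL := jobs_opDL t
  obtain ⟨n, i, j, k⟩ := t
  obtain ⟨m, i', j', k'⟩ := s
  simp only [Prod.mk_le_mk] at hst
  obtain ⟨h1, h2, h3, h4⟩ := hst
  obtain rfl | rfl : i = 0 ∨ i = 1 := by omega
  · obtain rfl : i' = 0 := by omega
    simp only [localRate]
    norm_num
    nlinarith
  · obtain rfl | rfl : i' = 0 ∨ i' = 1 := by omega
    · have h := hB (m, 0, j', k') (opDL (n, 1, j, k)) (by
        simp only [opDL, Prod.mk_le_mk]; refine ⟨h1, le_rfl, h3, by omega⟩) hDL.le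
      simp only [localRate]
      norm_num
      nlinarith
    · have h := hB (opDL (m, 1, j', k')) (opDL (n, 1, j, k)) (by
        simp only [opDL, Prod.mk_le_mk]; refine ⟨h1, le_rfl, h3, by omega⟩) hDL.le
      simp only [localRate]
      norm_num
      nlinarith

/-- Comparison of the cloud transitions in two ordered states, after uniformization. -/
theorem cloudRate_compare {B : ℝ} {s t : State} (hst : s ≤ t)
    (hB : ∀ s' t' : State, s' ≤ t' → jobs t' ≤ jobs t → -B ≤ v t' - v s') :
    -(M.muC2 * (B + (v t - v s))) ≤
      cloudRate M t * (v (cloudDeparture t) - v t) -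
        cloudRate M s * (v (cloudDeparture s) - v s) := by
  have hc := M.muC1_pos
  have hcd := M.muC1_lt_muC2
  have h0 := hB s t hst le_rfl
  have hC := jobs_cloudDeparture_le t
  obtain ⟨n, i, j, k⟩ := t
  obtain ⟨m, i', j', k'⟩ := s
  simp only [Prod.mk_le_mk] at hst
  obtain ⟨h1, h2, h3, h4⟩ := hst
  rcases k with _ | k
  · obtain rfl : k' = 0 := by omega
    obtain rfl | rfl : j = 0 ∨ j = 1 := by omega
    · obtain rfl : j' = 0 := by omega
      simp only [cloudRate]
      norm_num
      nlinarith
    · obtain rfl | rfl : j' = 0 ∨ j' = 1 := by omega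
      · have h := hB (m, i', 0, 0) (n, i, 0, 0) (by
          simp only [Prod.mk_le_mk]; exact ⟨h1, h2, le_rfl, le_rfl⟩) hC
        simp only [cloudRate, cloudDeparture, opD1]
        norm_num
        nlinarith
      · have h := hB (m, i', 0, 0) (n, i, 0, 0) (by
          simp only [Prod.mk_le_mk]; exact ⟨h1, h2, le_rfl, le_rfl⟩) hC
        simp only [cloudRate, cloudDeparture, opD1]
        norm_num
        nlinarith
  · have hC' : jobs (n, i, j, k) ≤ jobs (n, i, j, k + 1) := by simp only [jobs]; omega
    rcases k' with _ | k'
    · have h := hB (m, i', j', 0) (n, i, j, k) (by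
        simp only [Prod.mk_le_mk]; exact ⟨h1, h2, h3, by omega⟩) hC'
      obtain rfl | rfl : j' = 0 ∨ j' = 1 := by omega
      · simp only [cloudRate, cloudDeparture, opD2]
        norm_num
        nlinarith
      -- Both clouds complete together at rate μ_c1; at the remaining rate μ_c2 - μ_c1 only `t`
      -- loses a job, a mode 2 job that `s` lacks. Order survives both events.
      · have h' := hB (m, i', 0, 0) (n, i, j, k) (by
          simp only [Prod.mk_le_mk]; exact ⟨h1, h2, by omega, by omega⟩) hC'
        simp only [cloudRate, cloudDeparture, opD2, opD1]
        norm_num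
        nlinarith
    · have h := hB (m, i', j', k') (n, i, j, k) (by
        simp only [Prod.mk_le_mk]; exact ⟨h1, h2, h3, by omega⟩) hC'
      simp only [cloudRate, cloudDeparture, opD2]
      norm_num
      nlinarith

theorem jobs_mono {s t : State} (hst : s ≤ t) : jobs s ≤ jobs t := by
  obtain ⟨n, i, j, k⟩ := t
  obtain ⟨m, i', j', k'⟩ := s
  simp only [Prod.mk_le_mk] at hst
  obtain ⟨h1, h2, h3, h4⟩ := hst
  simp only [jobs]
  omega

theorem opA_mono {s t : State} (hst : s ≤ t) : opA s ≤ opA t := by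
  obtain ⟨n, i, j, k⟩ := t
  obtain ⟨m, i', j', k'⟩ := s
  simp only [Prod.mk_le_mk] at hst
  simp only [opA, Prod.mk_le_mk]
  exact ⟨by omega, hst.2⟩

/-- Both states are uniformized to total rate λ + μ_l2 + μ_c2. Idling need not be optimal in the
smaller state: there the inequality `le_idle` already points the right way. -/
theorem IsOptimalValue.sub_ge_of_idle (hβ : 0 < β) (hv : IsOptimalValue M β v) {K : ℝ} (hK : 0 ≤ K)
    (he : ∀ s t : State, s ≤ t → -(K * weight M β t) ≤ v t - v s) {s t : State} (hst : s ≤ t)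
    (ht : (β + totalRate M t) * v t = idleRHS M v t) :
    -(contraction M β * K * weight M β t) ≤ v t - v s := by
  have hB : ∀ s' t' : State, s' ≤ t' → jobs t' ≤ jobs t → -(K * weight M β t) ≤ v t' - v s' := by
    intro s' t' h1 h2
    have h3 := he s' t' h1
    have h4 := mul_le_mul_of_nonneg_left (weight_mono M β h2) hK
    linarith
  have hL := localRate_compare (M := M) hst hB
  have hC := cloudRate_compare (M := M) hst hB
  have hA := he _ _ (opA_mono hst)
  rw [weight_opA] at hA
  have hA' := mul_le_mul_of_nonneg_left hA M.lam_pos.le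
  have hs := hv.le_idle s
  have hj : (jobs s : ℝ) ≤ jobs t := Nat.cast_le.mpr (jobs_mono hst)
  unfold idleRHS totalRate at hs ht
  have hR : M.lam + M.muL2 + M.muC2 ≤ M.rateBound := by
    have := M.muC1_pos
    unfold Model.rateBound
    linarith
  have hw := mul_le_mul_of_nonneg_left
    (rate_mul_weight_le M hβ hR (two_lam_div_le_weight M β t)) hK
  have hlam := M.lam_pos
  have hν := M.muL2_pos
  have hd := M.muC2_pos
  refine le_of_mul_le_mul_right (a := M.lam + M.muL2 + M.muC2 + β) ?_ (by positivity)
  linarith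

theorem IsOptimalValue.monotone (hβ : 0 < β) (hv : IsOptimalValue M β v) : Monotone v := by
  obtain ⟨K₀, hK₀, hbd⟩ := hv.exists_le_weight
  intro s t hst
  rw [← sub_nonneg]
  refine nonneg_of_contraction (ι := {p : State × State // p.1 ≤ p.2})
    (e := fun p => v p.1.2 - v p.1.1) (w := fun p => weight M β p.1.2)
    (contraction_nonneg M hβ) (contraction_lt_one M hβ) hK₀ ?_ ?_ ⟨(s, t), hst⟩
  · rintro ⟨⟨s, t⟩, hst⟩
    have h1 := hbd s
    have h2 := hv.nonneg t
    have h4 := mul_le_mul_of_nonneg_left (weight_mono M β (jobs_mono hst)) hK₀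
    dsimp only
    linarith
  · intro K hK he
    have he' : ∀ s t : State, s ≤ t → -(K * weight M β t) ≤ v t - v s := fun s t h =>
      he ⟨(s, t), h⟩
    -- Assignments take no time and yield no contraction, but they shorten the base queue of the
    -- larger state; induction on its length leads to a state where idling is optimal.
    suffices H : ∀ N : ℕ, ∀ s t : State, t.1 = N → s ≤ t →
        -(contraction M β * K * weight M β t) ≤ v t - v s from
      fun p => H p.1.2.1 p.1.1 p.1.2 rfl p.2
    intro N
    induction N with
    | zero =>
      intro s t hN hst
      rcases hv.attained t with h | ⟨h, -⟩ | ⟨h, -⟩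
      · exact hv.sub_ge_of_idle hβ hK he' hst h
      · obtain ⟨n, i, j, k⟩ := t
        have := (SM1_mem_admissible.mp h).1
        simp only at hN
        omega
      · obtain ⟨n, i, j, k⟩ := t
        have := (SM2_mem_admissible.mp h).1
        simp only at hN
        omega
    | succ N ih =>
      intro s t hN hst
      rcases hv.attained t with h | ⟨h, h'⟩ | ⟨h, h'⟩
      · exact hv.sub_ge_of_idle hβ hK he' hst h
      · obtain ⟨n, i, j, k⟩ := t
        obtain ⟨m, i', j', k'⟩ := s
        obtain ⟨-, rfl⟩ := SM1_mem_admissible.mp h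
        simp only at hN
        subst hN
        simp only [Prod.mk_le_mk] at hst
        obtain ⟨h1, h2, h3, h4⟩ := hst
        obtain rfl : j' = 0 := by omega
        have hw : weight M β (N + 1, i, 0, k) = weight M β (N, i, 1, k) := by
          simp only [weight, jobs, Fin.val_zero, Fin.val_one]; push_cast; ring
        have h'' : v (N + 1, i, 0, k) = v (N, i, 1, k) := h'
        rw [h'', hw]
        rcases Nat.lt_or_ge m (N + 1) with hm | hm
        · exact ih (m, i', 0, k') (N, i, 1, k) rfl (by
            simp only [Prod.mk_le_mk]; exact ⟨by omega, h2, by omega, h4⟩)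
        -- With equal base queues the assigned state no longer dominates `s`; the same assignment is
        -- then admissible in `s` and restores the order.
        · obtain rfl : m = N + 1 := by omega
          have h5 := ih (N, i', 1, k') (N, i, 1, k) rfl (by
            simp only [Prod.mk_le_mk]; exact ⟨le_rfl, h2, le_rfl, h4⟩)
          have h6 := hv.le_SM1 N k' i'
          linarith
      · obtain ⟨n, i, j, k⟩ := t
        obtain ⟨m, i', j', k'⟩ := s
        obtain ⟨-, rfl⟩ := SM2_mem_admissible.mp h
        simp only at hN
        subst hN
        simp only [Prod.mk_le_mk] at hst
        obtain ⟨h1, h2, h3, h4⟩ := hst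
        obtain rfl : i' = 0 := by omega
        have hw : weight M β (N + 1, 0, j, k) = weight M β (N, 1, j, k) := by
          simp only [weight, jobs, Fin.val_zero, Fin.val_one]
        have h'' : v (N + 1, 0, j, k) = v (N, 1, j, k) := h'
        rw [h'', hw]
        rcases Nat.lt_or_ge m (N + 1) with hm | hm
        · exact ih (m, 0, j', k') (N, 1, j, k) rfl (by
            simp only [Prod.mk_le_mk]; exact ⟨by omega, by omega, h3, h4⟩)
        · obtain rfl : m = N + 1 := by omega
          have h5 := ih (N, 1, j', k') (N, 1, j, k) rfl (by
            simp only [Prod.mk_le_mk]; exact ⟨le_rfl, le_rfl, h3, h4⟩)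
          have h6 := hv.le_SM2 N k' j'
          linarith

/-! ### Comparison of cloud-busy and cloud-empty states -/

/-- A minimum principle for birth-death recursions with killing on the natural numbers. -/
theorem nonneg_of_birthDeath {e : ℕ → ℝ} {a c q C : ℝ} (ha : 0 ≤ a) (hc : 0 ≤ c) (hq : a + c < q)
    (hC : 0 ≤ C) (hbd : ∀ n : ℕ, -(C * (n + 1)) ≤ e n) (h0 : a * min (e 1) 0 ≤ q * e 0)
    (hs : ∀ n, a * min (e (n + 2)) 0 + c * min (e n) 0 ≤ q * e (n + 1)) (n : ℕ) : 0 ≤ e n := by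
  have hδ : 0 < q - a - c := by linarith
  -- The weight n + 1 + L grows by one at a birth; `L` is so large that half of the killing rate q -
  -- a - c absorbs this drift.
  set L : ℝ := 2 * a / (q - a - c) with hL
  have hL0 : 0 ≤ L := by positivity
  have hLa : L * (q - a - c) = 2 * a := by rw [hL]; field_simp
  have hq0 : 0 < q := by linarith
  refine nonneg_of_contraction (w := fun n : ℕ => (n : ℝ) + 1 + L) (ρ := (a + c + q) / (2 * q))
    (K₀ := C) (by positivity) (by rw [div_lt_one (by positivity)]; linarith) hC
    (fun n => by nlinarith [hbd n, mul_nonneg hC hL0]) (fun K hK he n => ?_) n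
  have hmin : ∀ n : ℕ, -(K * (n + 1 + L)) ≤ min (e n) 0 := fun n =>
    le_min (he n) (by have : 0 ≤ K * ((n : ℝ) + 1 + L) := by positivity
                      linarith)
  have hρ : ∀ w : ℝ, (a + c + q) / (2 * q) * K * w * q = (a + c + q) / 2 * K * w := by
    intro w; field_simp
  refine le_of_mul_le_mul_right (a := q) ?_ hq0
  rw [neg_mul, hρ]
  rcases n with _ | n
  · have h1 := mul_le_mul_of_nonneg_left (hmin 1) ha
    have h2 : 0 ≤ K * (q - a - c) := by positivity
    have h3 : 0 ≤ K * c * (1 + L) := by positivity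
    push_cast at h1 ⊢
    nlinarith [congrArg (fun x => K * x) hLa]
  · have h1 := mul_le_mul_of_nonneg_left (hmin (n + 2)) ha
    have h2 := mul_le_mul_of_nonneg_left (hmin n) hc
    have h3 : 0 ≤ K * (q - a - c) * (n + 2) := by positivity
    have h4 : 0 ≤ K * c := by positivity
    have h5 := hs n
    push_cast at h1 h2 ⊢
    nlinarith [congrArg (fun x => K * x) hLa]

theorem nonneg_of_birth {e : ℕ → ℝ} {a q C : ℝ} (ha : 0 ≤ a) (hq : a < q)
    (hC : 0 ≤ C) (hbd : ∀ n : ℕ, -(C * (n + 1)) ≤ e n)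
    (hs : ∀ n, 0 ≤ e n ∨ a * e (n + 1) ≤ q * e n) (n : ℕ) : 0 ≤ e n := by
  have h : ∀ n, a * min (e (n + 1)) 0 ≤ q * e n := by
    intro n
    rcases hs n with h | h
    · exact (mul_nonpos_of_nonneg_of_nonpos ha (min_le_right _ _)).trans
        (mul_nonneg (ha.trans hq.le) h)
    · exact (mul_le_mul_of_nonneg_left (min_le_left _ _) ha).trans h
  exact nonneg_of_birthDeath (c := 0) ha le_rfl (by linarith) hC hbd (h 0)
    (fun n => by simpa using h (n + 1)) n

theorem IsOptimalValue.exists_linear_bound (hβ : 0 < β) (hv : IsOptimalValue M β v) :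
    ∃ C, 0 ≤ C ∧ ∀ (n : ℕ) (s : State), jobs s ≤ n + 2 → v s ≤ C * (n + 1) := by
  obtain ⟨K, hK, h⟩ := hv.exists_le_weight
  have hL : 0 ≤ 2 * M.lam / β := (div_pos (mul_pos two_pos M.lam_pos) hβ).le
  refine ⟨K * (2 + 2 * M.lam / β), by positivity, fun n s hs => (h s).trans ?_⟩
  rw [mul_assoc]
  refine mul_le_mul_of_nonneg_left ?_ hK
  have : (jobs s : ℝ) ≤ n + 2 := by exact_mod_cast hs
  have hn : (0 : ℝ) ≤ n := Nat.cast_nonneg n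
  unfold weight
  nlinarith

/-- Template for the comparisons below: if an assignment is optimal in `A n`, the inequality is
obtained directly; if idling is, uniformization leaves only the arrival term, which
`nonneg_of_birth` controls. -/
theorem IsOptimalValue.comparison (hβ : 0 < β) (hv : IsOptimalValue M β v) {A B : ℕ → State}
    {q : ℝ} (hq : M.lam < q) (hB : ∀ n, jobs (B n) ≤ n + 2)
    (h : ∀ n, v (B n) ≤ v (A n) ∨
      M.lam * (v (A (n + 1)) - v (B (n + 1))) ≤ q * (v (A n) - v (B n))) (n : ℕ) :
    v (B n) ≤ v (A n) := by
  obtain ⟨C, hC, hbd⟩ := hv.exists_linear_bound hβ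
  rw [← sub_nonneg]
  refine nonneg_of_birth (e := fun n => v (A n) - v (B n)) M.lam_pos.le hq hC (fun n => ?_)
    (fun n => ?_) n
  · linarith [hbd n (B n) (hB n), hv.nonneg (A n)]
  · rw [sub_nonneg]; exact h n

/-- A job in cloud service under mode 1 is preferable to a job in local service under mode 2. -/
theorem IsOptimalValue.SM1_le_local (hβ : 0 < β) (hv : IsOptimalValue M β v) (n : ℕ) :
    v (n, 0, 1, 0) ≤ v (n, 1, 0, 0) := by
  have hc := M.muC1_pos
  have hν := M.muL2_pos
  have hνc := M.muL2_lt_muC1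
  have hmono := hv.monotone hβ
  refine hv.comparison hβ (A := fun n => (n, 1, 0, 0)) (B := fun n => (n, 0, 1, 0))
    (q := β + M.lam + M.muC1) (by linarith) (fun n => by simp [jobs]) (fun n => ?_) n
  rcases hv.attained (n, 1, 0, 0) with h | ⟨h, h'⟩ | ⟨h, -⟩
  · right
    have h2 := hv.le_idle (n, 0, 1, 0)
    simp [idleRHS, totalRate, localRate, cloudRate, opA, opDL, cloudDeparture, opD1, jobs]
      at h h2
    -- The local completion is paired with part of the faster cloud completion; the excess rate μ_c1
    -- - μ_l2 is paired with a fictitious event in the other state.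
    have e1 : v (n, 0, 0, 0) ≤ v (n, 0, 0, 1) := hmono (by simp [Prod.mk_le_mk])
    have e2 : v (n, 0, 0, 0) ≤ v (n, 1, 0, 0) := hmono (by simp [Prod.mk_le_mk])
    nlinarith [mul_le_mul_of_nonneg_left e1 hν.le,
      mul_le_mul_of_nonneg_left e2 (sub_nonneg.mpr hνc.le)]
  · left
    obtain ⟨hn, -⟩ := SM1_mem_admissible.mp h
    obtain ⟨m, rfl⟩ := Nat.exists_eq_add_of_le' hn
    rw [h']
    -- Both states reach (m, 1, 1, 0) by one assignment, and that assignment is optimal in the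
    -- first.
    exact hv.le_SM2 m 0 1
  · exact absurd (SM2_mem_admissible.mp h).2 (by decide)

/-- Local completion of the mode 2 job is profitable while a mode 1 job is at the cloud. -/
theorem IsOptimalValue.cloud_le_local (hβ : 0 < β) (hv : IsOptimalValue M β v) (n : ℕ) :
    v (n, 0, 1, 1) ≤ v (n, 1, 1, 0) := by
  have hc := M.muC1_pos
  have hd := M.muC2_pos
  have hν := M.muL2_pos
  have hcd := M.muC1_lt_muC2
  have hmono := hv.monotone hβ
  refine hv.comparison hβ (A := fun n => (n, 1, 1, 0)) (B := fun n => (n, 0, 1, 1))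
    (q := β + M.lam + M.muC2 + M.muL2) (by linarith) (fun n => by simp [jobs]) (fun n => ?_) n
  rcases hv.attained (n, 1, 1, 0) with h | ⟨h, -⟩ | ⟨h, -⟩
  · right
    have h2 := hv.le_idle (n, 0, 1, 1)
    simp [idleRHS, totalRate, localRate, cloudRate, opA, opDL, cloudDeparture, opD1, opD2, jobs]
      at h h2
    -- The local completion leads exactly to the comparison state, so it cancels against a
    -- fictitious event there.
    have e1 := hv.SM1_le_local hβ n
    have e2 : v (n, 0, 1, 0) ≤ v (n, 1, 1, 0) := hmono (by simp [Prod.mk_le_mk])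
    nlinarith [mul_le_mul_of_nonneg_left e1 hc.le,
      mul_le_mul_of_nonneg_left e2 (sub_nonneg.mpr hcd.le)]
  · exact absurd (SM1_mem_admissible.mp h).2 (by decide)
  · exact absurd (SM2_mem_admissible.mp h).2 (by decide)

/-- Mode 1 is optimal when both servers are empty. -/
theorem IsOptimalValue.SM1_le_base (hβ : 0 < β) (hv : IsOptimalValue M β v) (n : ℕ) :
    v (n, 0, 1, 0) ≤ v (n + 1, 0, 0, 0) := by
  have hc := M.muC1_pos
  have hmono := hv.monotone hβ
  refine hv.comparison hβ (A := fun n => (n + 1, 0, 0, 0)) (B := fun n => (n, 0, 1, 0))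
    (q := β + M.lam + M.muC1) (by linarith) (fun n => by simp [jobs]) (fun n => ?_) n
  rcases hv.attained (n + 1, 0, 0, 0) with h | ⟨-, h'⟩ | ⟨-, h'⟩
  · right
    have h2 := hv.le_idle (n, 0, 1, 0)
    simp [idleRHS, totalRate, localRate, cloudRate, opA, opDL, cloudDeparture, opD1, jobs]
      at h h2
    have e1 : v (n, 0, 0, 0) ≤ v (n + 1, 0, 0, 0) := hmono (by simp [Prod.mk_le_mk])
    nlinarith [mul_le_mul_of_nonneg_left e1 hc.le]
  · left
    rw [h']
    exact le_rfl
  · left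
    rw [h']
    exact hv.SM1_le_local hβ n

/-- A mode 2 job that only awaits its cloud service is preferable to a job in the base queue. -/
theorem IsOptimalValue.cloud_le_base (hβ : 0 < β) (hv : IsOptimalValue M β v) (n : ℕ) :
    v (n, 0, 1, 1) ≤ v (n + 1, 0, 1, 0) := by
  have hc := M.muC1_pos
  have hd := M.muC2_pos
  have hcd := M.muC1_lt_muC2
  have hmono := hv.monotone hβ
  refine hv.comparison hβ (A := fun n => (n + 1, 0, 1, 0)) (B := fun n => (n, 0, 1, 1))
    (q := β + M.lam + M.muC2) (by linarith) (fun n => by simp [jobs]) (fun n => ?_) n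
  rcases hv.attained (n + 1, 0, 1, 0) with h | ⟨h, -⟩ | ⟨-, h'⟩
  · right
    have h2 := hv.le_idle (n, 0, 1, 1)
    simp [idleRHS, totalRate, localRate, cloudRate, opA, opDL, cloudDeparture, opD1, opD2, jobs]
      at h h2
    have e1 := hv.SM1_le_base hβ n
    have e2 : v (n, 0, 1, 0) ≤ v (n + 1, 0, 1, 0) := hmono (by simp [Prod.mk_le_mk])
    nlinarith [mul_le_mul_of_nonneg_left e1 hc.le,
      mul_le_mul_of_nonneg_left e2 (sub_nonneg.mpr hcd.le)]
  · exact absurd (SM1_mem_admissible.mp h).2 (by decide)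
  · left
    rw [h']
    exact hv.cloud_le_local hβ n

/-! ### The gap between idling and mode 2 -/

/-- The cost-to-go in state `(n, 0, 1, 0)` if the system idles until the next transition. -/
noncomputable def idleValue (M : Model) (β : ℝ) (v : State → ℝ) (n : ℕ) : ℝ :=
  idleRHS M v (n, 0, 1, 0) / (β + totalRate M (n, 0, 1, 0))

/-- The advantage of mode 2 over idling in state `(n + 1, 0, 1, 0)`. -/
noncomputable def modeGap (M : Model) (β : ℝ) (v : State → ℝ) (n : ℕ) : ℝ :=
  idleValue M β v (n + 1) - v (n, 1, 1, 0)

theorem idleValue_spec (hβ : 0 < β) (n : ℕ) :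
    (β + totalRate M (n, 0, 1, 0)) * idleValue M β v n = idleRHS M v (n, 0, 1, 0) := by
  have := totalRate_pos M (n, 0, 1, 0)
  unfold idleValue
  field_simp

theorem idleValue_mul (hβ : 0 < β) (n : ℕ) :
    (β + M.lam + M.muC1) * idleValue M β v n =
      n + 1 + M.lam * v (n + 1, 0, 1, 0) + M.muC1 * v (n, 0, 0, 0) := by
  have h := idleValue_spec (M := M) (v := v) hβ n
  simp [idleRHS, totalRate, localRate, cloudRate, opA, cloudDeparture, opD1, jobs] at h
  linarith

theorem IsOptimalValue.le_idleValue (hβ : 0 < β) (hv : IsOptimalValue M β v) (n : ℕ) :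
    v (n, 0, 1, 0) ≤ idleValue M β v n := by
  have := totalRate_pos M (n, 0, 1, 0)
  refine le_of_mul_le_mul_left (a := β + totalRate M (n, 0, 1, 0)) ?_ (by linarith)
  rw [idleValue_spec hβ]
  exact hv.le_idle _

theorem IsOptimalValue.min_modeGap_le (hβ : 0 < β) (hv : IsOptimalValue M β v) (n : ℕ) :
    v (n, 1, 1, 0) + min (modeGap M β v n) 0 ≤ v (n + 1, 0, 1, 0) := by
  have hT := totalRate_pos M (n + 1, 0, 1, 0)
  rcases hv.attained (n + 1, 0, 1, 0) with h | ⟨h, -⟩ | ⟨-, h'⟩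
  · rw [← idleValue_spec hβ] at h
    have h2 := mul_left_cancel₀ (by positivity) h
    rw [h2]
    have := min_le_left (modeGap M β v n) 0
    unfold modeGap at this ⊢
    linarith
  · exact absurd (SM1_mem_admissible.mp h).2 (by decide)
  · have h2 : v (n + 1, 0, 1, 0) = v (n, 1, 1, 0) := h'
    rw [h2]
    linarith [min_le_right (modeGap M β v n) 0]

/-- The extra job costs one per unit time until the next event, and monotonicity keeps the
difference nonnegative afterwards. -/
theorem IsOptimalValue.idleValue_sub_ge (hβ : 0 < β) (hv : IsOptimalValue M β v) (n : ℕ) :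
    1 ≤ (β + M.lam + M.muC1) * (idleValue M β v (n + 1) - v (n, 0, 1, 0)) := by
  have hmono := hv.monotone hβ
  have h1 := idleValue_mul (M := M) (v := v) hβ (n + 1)
  have h2 := hv.le_idle (n, 0, 1, 0)
  simp [idleRHS, totalRate, localRate, cloudRate, opA, cloudDeparture, opD1, jobs] at h2
  have e1 : v (n + 1, 0, 1, 0) ≤ v (n + 1 + 1, 0, 1, 0) := hmono (by simp [Prod.mk_le_mk])
  have e2 : v (n, 0, 0, 0) ≤ v (n + 1, 0, 0, 0) := hmono (by simp [Prod.mk_le_mk])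
  push_cast at h1
  nlinarith [mul_le_mul_of_nonneg_left e1 M.lam_pos.le,
    mul_le_mul_of_nonneg_left e2 M.muC1_pos.le]

/-- A lower bound for the gain from the faster service of mode 2 jobs at the cloud. -/
noncomputable def cloudGain (M : Model) (β : ℝ) : ℝ :=
  (M.muC2 - M.muC1) / ((β + M.lam + M.muC2) * (β + M.lam + M.muC1))

theorem cloudGain_pos (M : Model) (hβ : 0 < β) : 0 < cloudGain M β := by
  have := M.lam_pos
  have := M.muC1_pos
  have := M.muC2_pos
  have := sub_pos.mpr M.muC1_lt_muC2
  unfold cloudGain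
  positivity

/-- At the common rate λ + μ_c2, arrivals and paired cloud completions contribute nonnegatively. The
excess rate μ_c2 - μ_c1 removes a job only in the mode 2 state, which yields the strict gain of
`idleValue_sub_ge`. -/
theorem IsOptimalValue.cloudGain_le (hβ : 0 < β) (hv : IsOptimalValue M β v) (n : ℕ) :
    cloudGain M β ≤ idleValue M β v (n + 1) - v (n, 0, 1, 1) := by
  have hl := M.lam_pos
  have hc := M.muC1_pos
  have hd := M.muC2_pos
  have hcd := sub_pos.mpr M.muC1_lt_muC2
  have h1 := idleValue_mul (M := M) (v := v) hβ (n + 1)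
  have h2 := hv.le_idle (n, 0, 1, 1)
  simp [idleRHS, totalRate, localRate, cloudRate, opA, cloudDeparture, opD2, jobs] at h2
  have e1 := hv.cloud_le_base hβ (n + 1)
  have e2 := hv.SM1_le_base hβ n
  have e3 : 1 / (β + M.lam + M.muC1) ≤ idleValue M β v (n + 1) - v (n, 0, 1, 0) := by
    rw [div_le_iff₀' (by positivity)]
    exact hv.idleValue_sub_ge hβ n
  have : cloudGain M β = (M.muC2 - M.muC1) * (1 / (β + M.lam + M.muC1)) / (β + M.lam + M.muC2) := by
    unfold cloudGain; field_simp
  rw [this, div_le_iff₀ (by positivity)]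
  push_cast at h1
  nlinarith [mul_le_mul_of_nonneg_left e1 hl.le, mul_le_mul_of_nonneg_left e2 hc.le,
    mul_le_mul_of_nonneg_left e3 hcd.le]

/-- An arrival shifts the gap up by one. After a cloud completion, mode 1 is optimal on the idling
side and merely admissible on the other, which shifts the gap down by one. The local completion
supplies the source term. -/
theorem IsOptimalValue.modeGap_recursion (hβ : 0 < β) (hv : IsOptimalValue M β v) (n : ℕ) :
    M.lam * min (modeGap M β v (n + 2)) 0 + M.muC1 * min (modeGap M β v n) 0 +
      M.muL2 * cloudGain M β ≤
      (β + M.lam + M.muC1 + M.muL2) * modeGap M β v (n + 1) := by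
  have h1 := idleValue_mul (M := M) (v := v) hβ (n + 2)
  have h2 := hv.le_idle (n + 1, 1, 1, 0)
  simp [idleRHS, totalRate, localRate, cloudRate, opA, opDL, cloudDeparture, opD1, jobs] at h2
  have e1 := hv.min_modeGap_le hβ (n + 2)
  have e2 := hv.min_modeGap_le hβ n
  have e3 := hv.SM1_le_base hβ (n + 1)
  have e4 := hv.le_SM1 n 0 1
  have e5 := hv.cloudGain_le hβ (n + 1)
  have e6 : v (n, 1, 1, 0) + min (modeGap M β v n) 0 ≤ v (n + 1 + 1, 0, 0, 0) := e2.trans e3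
  unfold modeGap at *
  push_cast at h1
  nlinarith [mul_le_mul_of_nonneg_left e1 M.lam_pos.le, mul_le_mul_of_nonneg_left e6 M.muC1_pos.le,
    mul_le_mul_of_nonneg_left e4 M.muC1_pos.le, mul_le_mul_of_nonneg_left e5 M.muL2_pos.le]

theorem IsOptimalValue.exists_modeGap_bound (hβ : 0 < β) (hv : IsOptimalValue M β v) :
    ∃ C, 0 ≤ C ∧ ∀ n : ℕ, -(C * (n + 1)) ≤ modeGap M β v n := by
  obtain ⟨C, hC, hbd⟩ := hv.exists_linear_bound hβ
  refine ⟨C, hC, fun n => ?_⟩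
  have h1 := hbd n (n, 1, 1, 0) (by simp [jobs])
  have h2 := (hv.nonneg _).trans (hv.le_idleValue hβ (n + 1))
  unfold modeGap
  linarith

/-- If mode 2 is optimal, it is strictly optimal with one more job in the base queue. -/
theorem IsOptimalValue.modeGap_succ_pos (hβ : 0 < β) (hv : IsOptimalValue M β v) {n : ℕ}
    (hn : 0 ≤ modeGap M β v n) : 0 < modeGap M β v (n + 1) := by
  have hl := M.lam_pos
  have hc := M.muC1_pos
  have hg := mul_pos M.muL2_pos (cloudGain_pos M hβ)
  obtain ⟨C, hC, hbd⟩ := hv.exists_modeGap_bound hβ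
  have hrec := hv.modeGap_recursion hβ
  have h0 := hrec n
  rw [min_eq_right hn] at h0
  -- Since the gap is nonnegative at `n`, the death term vanishes at `n + 1`, which becomes the
  -- boundary of a shifted half-line.
  have hnn : ∀ j, 0 ≤ modeGap M β v (n + 1 + j) := by
    refine nonneg_of_birthDeath (e := fun j => modeGap M β v (n + 1 + j))
      (q := β + M.lam + M.muC1 + M.muL2) (C := C * (n + 2)) hl.le hc.le
      (by linarith [M.muL2_pos]) (by positivity) (fun j => ?_) ?_ (fun j => ?_)
    · refine le_trans ?_ (hbd (n + 1 + j))
      push_cast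
      have : 0 ≤ C * ((n + 1) * j) := by positivity
      nlinarith
    · change M.lam * min (modeGap M β v (n + 2)) 0 ≤ _ * modeGap M β v (n + 1)
      linarith
    · have h := hrec (n + 1 + j)
      change M.lam * min (modeGap M β v (n + 1 + j + 2)) 0 + M.muC1 * min (modeGap M β v (n + 1 + j)) 0
        ≤ _ * modeGap M β v (n + 1 + j + 1)
      linarith
  have h2 : min (modeGap M β v (n + 2)) 0 = 0 := min_eq_right (hnn 1)
  rw [h2] at h0
  refine pos_of_mul_pos_right (a := β + M.lam + M.muC1 + M.muL2) ?_ (by linarith [M.muL2_pos])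
  linarith

/-- Mode 2 is optimal for some length of the base queue. -/
theorem IsOptimalValue.exists_modeGap_nonneg (hβ : 0 < β) (hv : IsOptimalValue M β v) :
    ∃ n, 0 ≤ modeGap M β v n := by
  have hl := M.lam_pos
  have hc := M.muC1_pos
  have hν := M.muL2_pos
  obtain ⟨C, hC, hbd⟩ := hv.exists_modeGap_bound hβ
  have hrec := hv.modeGap_recursion hβ
  set D := modeGap M β v with hD
  set q := β + M.lam + M.muC1 + M.muL2 with hq
  -- If D were always negative, the truncations would disappear and the recursion become linear. The
  -- constant `γ` solves it with equality, and r^n is a supersolution of the homogeneous part; `A`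
  -- makes the boundary value nonnegative. So D(n) ≥ γ - A r^n, which is eventually positive.
  set γ := M.muL2 * cloudGain M β / (β + M.muL2) with hγ
  have hγ0 : 0 < γ := div_pos (mul_pos hν (cloudGain_pos M hβ)) (by positivity)
  have hγq : M.muL2 * cloudGain M β = γ * (β + M.muL2) := by rw [hγ]; field_simp
  set r := M.muC1 / (M.muC1 + β) with hr
  have hr0 : 0 < r := by positivity
  have hr1 : r < 1 := by rw [hr, div_lt_one (by positivity)]; linarith
  have hrc : r * (M.muC1 + β) = M.muC1 := by rw [hr]; field_simp
  set A := γ + |D 0| with hA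
  have hA0 : 0 < A := by positivity
  by_contra! hneg
  have key : ∀ n : ℕ, 0 ≤ D n - γ + A * r ^ n := by
    refine nonneg_of_birthDeath (e := fun n => D n - γ + A * r ^ n) (q := q) (C := C + γ) hl.le hc.le
      (by linarith) (by positivity) (fun n => ?_) ?_ (fun n => ?_)
    · have h1 := hbd n
      have h2 : 0 ≤ A * r ^ n := by positivity
      have h3 : 0 ≤ γ * n := by positivity
      linarith
    · have h1 : 0 ≤ D 0 - γ + A * r ^ 0 := by
        rw [hA, pow_zero]; linarith [neg_abs_le (D 0)]
      exact (mul_nonpos_of_nonneg_of_nonpos hl.le (min_le_right _ _)).trans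
        (mul_nonneg (by linarith) h1)
    · have h1 := hrec n
      rw [min_eq_left (hneg _).le, min_eq_left (hneg _).le, hγq] at h1
      have h2 := mul_le_mul_of_nonneg_left (min_le_left (D (n + 2) - γ + A * r ^ (n + 2)) 0) hl.le
      have h3 := mul_le_mul_of_nonneg_left (min_le_left (D n - γ + A * r ^ n) 0) hc.le
      have hrn : 0 ≤ A * r ^ n := by positivity
      have h4 : M.lam * r ^ 2 + M.muC1 ≤ q * r := by
        have h5 : 0 ≤ M.lam * (r * (1 - r)) := by
          have := sub_pos.mpr hr1
          positivity
        have h6 : 0 ≤ M.muL2 * r := by positivity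
        rw [hq]
        nlinarith
      have h7 := mul_le_mul_of_nonneg_left h4 hrn
      have e1 : r ^ (n + 2) = r ^ n * r ^ 2 := pow_add _ _ _
      have e2 : r ^ (n + 1) = r ^ n * r := pow_succ _ _
      rw [e1] at h2 ⊢
      rw [e2]
      have e3 : q * γ = (M.lam + M.muC1) * γ + γ * (β + M.muL2) := by rw [hq]; ring
      linarith
  have hlim : Tendsto (fun n : ℕ => A * r ^ n) atTop (𝓝 0) := by
    simpa using (tendsto_pow_atTop_nhds_zero_of_lt_one hr0.le hr1).const_mul A
  obtain ⟨n, hn⟩ := (hlim.eventually_lt_const hγ0).exists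
  linarith [key n, hneg n]

theorem DelayOptimal.act_of_modeGap_pos (hβ : 0 < β) {π : Policy} (hπ : DelayOptimal M β π) {n : ℕ}
    (h : 0 < modeGap M β (realCost M β π) n) : π.act (n + 1, 0, 1, 0) = Action.SM2 := by
  have hT := totalRate_pos M (n + 1, 0, 1, 0)
  have hmem := π.act_mem (n + 1, 0, 1, 0)
  cases hs : π.act (n + 1, 0, 1, 0) with
  | SM2 => rfl
  | SM1 =>
    rw [hs] at hmem
    exact absurd (SM1_mem_admissible.mp hmem).2 (by decide)
  | idle =>
    have h1 := realCost_of_idle M hβ hs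
    rw [← idleValue_spec hβ] at h1
    have h2 := mul_left_cancel₀ (by positivity) h1
    have h3 := (hπ.isOptimalValue hβ).le_SM2 n 0 1
    unfold modeGap at h
    linarith

theorem DelayOptimal.act_of_modeGap_neg (hβ : 0 < β) {π : Policy} (hπ : DelayOptimal M β π) {n : ℕ}
    (h : modeGap M β (realCost M β π) n < 0) : π.act (n + 1, 0, 1, 0) = Action.idle := by
  have hmem := π.act_mem (n + 1, 0, 1, 0)
  cases hs : π.act (n + 1, 0, 1, 0) with
  | idle => rfl
  | SM1 =>
    rw [hs] at hmem
    exact absurd (SM1_mem_admissible.mp hmem).2 (by decide)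
  | SM2 =>
    have h1 := realCost_applyAction M hβ π (n + 1, 0, 1, 0)
    rw [hs] at h1
    have h2 : realCost M β π (n, 1, 1, 0) = realCost M β π (n + 1, 0, 1, 0) := h1
    have h3 := (hπ.isOptimalValue hβ).le_idleValue hβ (n + 1)
    unfold modeGap at h
    linarith

theorem Policy.act_zero (π : Policy) : π.act (0, 0, 1, 0) = Action.idle := by
  have hmem := π.act_mem (0, 0, 1, 0)
  cases hs : π.act (0, 0, 1, 0) with
  | idle => rfl
  | SM1 => rw [hs] at hmem; exact absurd (SM1_mem_admissible.mp hmem).1 (by decide)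
  | SM2 => rw [hs] at hmem; exact absurd (SM2_mem_admissible.mp hmem).1 (by decide)

theorem Policy.act_idle_or_SM2 (π : Policy) (n : ℕ) :
    π.act (n, 0, 1, 0) = Action.idle ∨ π.act (n, 0, 1, 0) = Action.SM2 := by
  have hmem := π.act_mem (n, 0, 1, 0)
  cases hs : π.act (n, 0, 1, 0) with
  | idle => exact Or.inl rfl
  | SM1 => rw [hs] at hmem; exact absurd (SM1_mem_admissible.mp hmem).2 (by decide)
  | SM2 => exact Or.inr rfl

end Offload

theorem mainTheorem2 (M : Offload.Model) (β : ℝ) (hβ : 0 < β) (π : Offload.Policy)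
    (hπ : Offload.DelayOptimal M β π) :
    ∃ N₀ : ℕ, ∀ n₀ : ℕ,
      (n₀ < N₀ → π.act (n₀, 0, 1, 0) = Offload.Action.idle) ∧
      (N₀ ≤ n₀ → π.act (n₀, 0, 1, 0) = Offload.Action.SM2) := by
  classical
  have hv := hπ.isOptimalValue hβ
  have hex := hv.exists_modeGap_nonneg hβ
  set m := Nat.find hex with hm
  -- Index shift: the gap at `n` concerns base queue length `n + 1`.
  have hbelow : ∀ n, n ≤ m → π.act (n, 0, 1, 0) = Offload.Action.idle := by
    rintro (_ | n) hn
    · exact π.act_zero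
    · exact hπ.act_of_modeGap_neg hβ (not_le.mp (Nat.find_min hex hn))
  have habove : ∀ n, m + 2 ≤ n → π.act (n, 0, 1, 0) = Offload.Action.SM2 := by
    have hpos : ∀ j, 0 < Offload.modeGap M β (Offload.realCost M β π) (m + 1 + j) := by
      intro j
      induction j with
      | zero => exact hv.modeGap_succ_pos hβ (Nat.find_spec hex)
      | succ j ih => exact hv.modeGap_succ_pos hβ ih.le
    intro n hn
    obtain ⟨j, rfl⟩ := Nat.exists_eq_add_of_le hn
    have := hπ.act_of_modeGap_pos hβ (hpos j)
    rwa [show m + 1 + j + 1 = m + 2 + j by ring] at this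
  -- The gap at `m` may be zero, in which case both actions are optimal at length `m + 1`; the
  -- threshold follows the choice made by the policy there.
  rcases π.act_idle_or_SM2 (m + 1) with h | h
  · refine ⟨m + 2, fun n => ⟨fun hn => ?_, habove n⟩⟩
    rcases Nat.lt_or_ge n (m + 1) with h1 | h1
    · exact hbelow n (by omega)
    · obtain rfl : n = m + 1 := by omega
      exact h
  · refine ⟨m + 1, fun n => ⟨fun hn => hbelow n (by omega), fun hn => ?_⟩⟩
    rcases Nat.lt_or_ge n (m + 2) with h1 | h1
    · obtain rfl : n = m + 1 := by omega
      exact h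
    · exact habove n h1
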